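/- **Setting.** Let $E$ (resources) and $T$ (types) be finite sets. Each type $t$ has a set of feasible strategies $\mathcal S_t\subseteq 2^{E}$, and each resource $e$ has a weakly increasing cost $c_e:\mathbb N\to\mathbb R_+$. In a Bernoulli congestion game each player $i$ of a finite set $N$ has a type $t_i\in T$ and a participation probability $r_i\in(0,1)$. Player $i$ chooses a mixed strategy $\sigma_i\in\Delta(\mathcal S_{t_i})$. The activity indicators $U_i\sim\mathrm{Bernoulli}(r_i)$ and the strategies $S_i\sim\sigma_i$ are all independent. Put $X_e=\sum_i U_i\mathbf 1_{\{e\in S_i\}}$ and $Z_{i,e}=\sum_{j\ne i}U_j\mathbf 1_{\{e\in S_j\}}$. The profile $\hat\sigma$ is a Bayes-Nash equilibrium if, for every player $i$ and all $s,s'\in\mathcal S_{t_i}$, $\hat\sigma_i(s)>0$ implies $\sum_{e\in s}\mathbb E_{\hat\sigma}[c_e(1+Z_{i,e})]\le\sum_{e\in s'}\mathbb E_{\hat\sigma}[c_e(1+Z_{i,e})]$. Let $\hat c_e(x)=\mathbb E[c_e(1+X)]$ with $X\sim\mathrm{Poisson}(x)$, $x\ge 0$. A Wardrop equilibrium for the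 costs $\hat c_e$ and demands $d=(d_t)_{t\in T}$ is a pair $(\hat y,\hat x)$ with $\hat y_{t,s}\ge0$, $\sum_{s\in\mathcal S_t}\hat y_{t,s}=d_t$ and $\hat x_e=\sum_t\sum_{s\in\mathcal S_t}\hat y_{t,s}\mathbf 1_{\{e\in s\}}$, such that $\hat y_{t,s}>0$ implies $\sum_{e\in s}\hat c_e(\hat x_e)\le\sum_{e\in s'}\hat c_e(\hat x_e)$ for all $t$ and all $s,s'\in\mathcal S_t$. For probability laws $P,Q$ on $\mathbb N$ let $\rho_{TV}(P,Q)=\sup_{A\subseteq\mathbb N}|P(A)-Q(A)|$. **Assumptions.** Consider a sequence of Bernoulli congestion games over the same $E$, $T$, $(\mathcal S_t)$, $(c_e)$, with player sets $N^n$, probabilities $r_i^n$ and types $t_i^n$. Put $r^n=\max_i r_i^n$ (with $r^n=0$ if $N^n=\emptyset$) and $d^n_t=\sum_{i:t^n_i=t}r^n_i$, and suppose that as $n\to\infty$ $$|N^n|\to\infty,\qquad r^n\to0,\qquad d^n_t\to d_t\quad(t\in T).$$ Let $\alpha>\sum_t d_t$ and $\nu\in\mathbb R$ be such that $\mathbb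 E|\Delta^2c_e(1+V)|\le\nu$ for all $e\in E$, where $V\sim\mathrm{Poisson}(\alpha)$ and $\Delta^2c_e(k)=c_e(k+2)-2c_e(k+1)+c_e(k)$. Suppose that $\sum_t d_t^n\le\alpha$ for all $n$, and that for some $\beta>0$ we have $\hat c_e'(x)\ge\beta$ for all $e\in E$ and $x\in[0,\alpha]$ (one-sided derivatives at the endpoints). Define $$\zeta=(e^\alpha-1)\nu+\max_{e}\,[c_e(2)-c_e(1)],\qquad \Lambda(r)=\frac{\alpha\nu}{2}\,\frac{r e^{r}}{(1-r)^2}+\zeta r,$$ $$\kappa=\max_{s}|s|,\qquad C=\max_{s}\sum_{e\in s}\hat c_e(\alpha),$$ where the last two maxima run over all feasible strategies $s\in\bigcup_t\mathcal S_t$. Let $\hat\sigma^n$ be a Bayes-Nash equilibrium of the $n$-th game for every $n$, and let $X_e^n$ be the corresponding random loads. **Conclusion.** The nonatomic game with costs $\hat c_e$ and demands $d$ has a Wardrop equilibrium, all its Wardrop equilibria have the same resource loads $(\hat x_e)_{e\in E}$, and for every $n$ and every $e\in E$ $$\rho_{TV}\bigl(\mathcal L(X_e^n),\mathrm{Poisson}(\hat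 x_e)\bigr)\le r^n+\sqrt{\frac{2\alpha\kappa}{\beta}}\,\sqrt{\Lambda(r^n)}+\sqrt{\frac{2C}{\beta}}\,\sqrt{\sum_{t\in T}|d^n_t-d_t|}.$$ -/

import Mathlib

open MeasureTheory ProbabilityTheory Filter Topology

noncomputable section

namespace CongestionGame

/-! ### Structural data -/

/-- The structural objects shared by all the games: resources `E`, types `T`, the feasible
strategies of each type (sets of resources) and, for each resource, a nonnegative weakly increasing
cost function of an integer load. -/
structure Structure (E T : Type*) where
  /-- the set of feasible strategies of each type -/
  strategies : T → Finset (Finset E)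
  /-- the cost of a resource as a function of its integer load -/
  cost : E → ℕ → ℝ
  cost_nonneg : ∀ e k, 0 ≤ cost e k
  cost_mono : ∀ e, Monotone (cost e)

/-! ### Nonatomic games and Wardrop equilibria -/

section Nonatomic

variable {E T : Type*} [Fintype T]

open scoped Classical in
/-- `(y, x)` is a feasible flow-load pair for the demands `d`. -/
structure IsFeasible (S : T → Finset (Finset E)) (d : T → ℝ)
    (y : (t : T) → S t → ℝ) (x : E → ℝ) : Prop where
  nonneg : ∀ t s, 0 ≤ y t s
  demand : ∀ t, d t = ∑ s, y t s
  load : ∀ e, x e = ∑ t, ∑ s : S t, y t s * (if e ∈ s.1 then 1 else 0)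

/-- `(y, x)` is a Wardrop equilibrium of the nonatomic congestion game with strategy sets `S`,
resource costs `c` and demands `d`. -/
structure IsWardrop (S : T → Finset (Finset E)) (c : E → ℝ → ℝ) (d : T → ℝ)
    (y : (t : T) → S t → ℝ) (x : E → ℝ) : Prop where
  feasible : IsFeasible S d y x
  optimal : ∀ t, ∀ s s' : S t, 0 < y t s → ∑ e ∈ s.1, c e (x e) ≤ ∑ e ∈ s'.1, c e (x e)

/-- `x` is the resource-load vector of some Wardrop equilibrium. -/
def IsWardropLoad (S : T → Finset (Finset E)) (c : E → ℝ → ℝ) (d : T → ℝ) (x : E → ℝ) : Prop :=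
  ∃ y : (t : T) → S t → ℝ, IsWardrop S c d y x

end Nonatomic

/-! ### Bernoulli congestion games -/

/-- The data of a Bernoulli congestion game with player set `N`: each player has a participation
probability in `(0, 1)` and a type. -/
structure Bernoulli (T N : Type*) where
  prob : N → ℝ
  type : N → T
  prob_pos : ∀ i, 0 < prob i
  prob_lt_one : ∀ i, prob i < 1

namespace Bernoulli

variable {E T N : Type*} [Fintype N]

/-- The maximal participation probability (`0` if there are no players). -/
def maxProb (Γ : Bernoulli T N) : ℝ := ⨆ i, Γ.prob i

open scoped Classical in
/-- The expected demand of type `t`. -/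
def demand (Γ : Bernoulli T N) (t : T) : ℝ := ∑ i with Γ.type i = t, Γ.prob i

/-- A vector of (candidate) mixed strategies: `σ i s` is the probability with which player `i`
chooses `s`, among the strategies of the type of `i`. -/
abbrev Profile (𝒢 : Structure E T) (Γ : Bernoulli T N) : Type _ :=
  (i : N) → 𝒢.strategies (Γ.type i) → ℝ

/-- `σ` is a mixed strategy profile: each `σ i` is a probability distribution. -/
def IsMixed (𝒢 : Structure E T) (Γ : Bernoulli T N) (σ : Profile 𝒢 Γ) : Prop :=
  ∀ i, σ i ∈ stdSimplex ℝ (𝒢.strategies (Γ.type i))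

/-- The sample space: who participates, and the pure strategy that each player chose. -/
abbrev Outcome (𝒢 : Structure E T) (Γ : Bernoulli T N) : Type _ :=
  (N → Bool) × ((i : N) → 𝒢.strategies (Γ.type i))

/-- The probability of an outcome. -/
def outcomeProb (𝒢 : Structure E T) (Γ : Bernoulli T N) (σ : Profile 𝒢 Γ)
    (ω : Outcome 𝒢 Γ) : ℝ :=
  ∏ i, (if ω.1 i then Γ.prob i else 1 - Γ.prob i) * σ i (ω.2 i)

open scoped Classical in
/-- Expectation of a real random variable on the (finite) sample space. -/
def expect (𝒢 : Structure E T) (Γ : Bernoulli T N) (σ : Profile 𝒢 Γ)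
    (f : Outcome 𝒢 Γ → ℝ) : ℝ :=
  ∑ ω, outcomeProb 𝒢 Γ σ ω * f ω

open scoped Classical in
/-- Indicator that player `i` is active and uses the resource `e`. -/
def uses (𝒢 : Structure E T) (Γ : Bernoulli T N) (i : N) (e : E) (ω : Outcome 𝒢 Γ) : ℕ :=
  if ω.1 i = true ∧ e ∈ (ω.2 i).1 then 1 else 0

/-- The random load of the resource `e`. -/
def load (𝒢 : Structure E T) (Γ : Bernoulli T N) (e : E) (ω : Outcome 𝒢 Γ) : ℕ :=
  ∑ i, uses 𝒢 Γ i e ω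

open scoped Classical in
/-- The random load that the players other than `i` put on the resource `e`. -/
def othersLoad (𝒢 : Structure E T) (Γ : Bernoulli T N) (i : N) (e : E) (ω : Outcome 𝒢 Γ) : ℕ :=
  ∑ j with j ≠ i, uses 𝒢 Γ j e ω

open scoped Classical in
/-- The law of the random load of the resource `e` under the profile `σ`. -/
def loadLaw (𝒢 : Structure E T) (Γ : Bernoulli T N) (σ : Profile 𝒢 Γ) (e : E) : Measure ℕ :=
  ∑ ω, ENNReal.ofReal (outcomeProb 𝒢 Γ σ ω) • Measure.dirac (load 𝒢 Γ e ω)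

/-- `σ` is a (mixed) Bayes-Nash equilibrium. -/
structure IsBNE (𝒢 : Structure E T) (Γ : Bernoulli T N) (σ : Profile 𝒢 Γ) : Prop where
  mixed : IsMixed 𝒢 Γ σ
  optimal : ∀ i, ∀ s s' : 𝒢.strategies (Γ.type i), 0 < σ i s →
    ∑ e ∈ s.1, expect 𝒢 Γ σ (fun ω => 𝒢.cost e (1 + othersLoad 𝒢 Γ i e ω)) ≤
      ∑ e ∈ s'.1, expect 𝒢 Γ σ (fun ω => 𝒢.cost e (1 + othersLoad 𝒢 Γ i e ω))

end Bernoulli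

/-! ### Total variation and Poisson costs -/

/-- Total variation distance between two probability measures on `ℕ`. -/
def tvDist (P Q : Measure ℕ) : ℝ := ⨆ A : Set ℕ, |P.real A - Q.real A|

/-- The Poisson law on `ℕ` with parameter `x ≥ 0` given as a real number. -/
def poisson (x : ℝ) : Measure ℕ := poissonMeasure x.toNNReal

section Costs

variable {E T : Type*} (𝒢 : Structure E T)

/-- The auxiliary cost `x ↦ E[c_e(1 + X)]` with `X ~ Poisson(x)`. -/
def poissonCost (e : E) (x : ℝ) : ℝ := ∫ k, 𝒢.cost e (1 + k) ∂poisson x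

/-- The second difference `k ↦ h(k+2) - 2 h(k+1) + h(k)`. -/
def secondDiff (h : ℕ → ℝ) (k : ℕ) : ℝ := h (k + 2) - 2 * h (k + 1) + h k

/-- `E|Δ² c_e(1 + V)|` is finite and at most `ν` for all resources `e`, with `V ~ Poisson(α)`. -/
def SecondDiffBound (α ν : ℝ) : Prop :=
  ∀ e, Integrable (fun k => secondDiff (𝒢.cost e) (1 + k)) (poisson α) ∧
    ∫ k, |secondDiff (𝒢.cost e) (1 + k)| ∂poisson α ≤ ν

/-- `ζ = (e^α - 1) ν + max_e (c_e(2) - c_e(1))`. -/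
def zeta (α ν : ℝ) : ℝ := (Real.exp α - 1) * ν + ⨆ e, (𝒢.cost e 2 - 𝒢.cost e 1)

/-- `Λ(r) = (α ν / 2) r e^r / (1 - r)² + ζ r`. -/
def Lam (α ν r : ℝ) : ℝ :=
  α * ν / 2 * (r * Real.exp r / (1 - r) ^ 2) + zeta 𝒢 α ν * r

/-- `κ`: the cardinality of the largest feasible strategy. -/
def maxCard [Fintype T] : ℕ := Finset.univ.sup fun t => (𝒢.strategies t).sup Finset.card

/-- `C`: the maximum over all feasible strategies `s` of `∑_{e ∈ s} ĉ_e(α)`. -/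
def maxCost (α : ℝ) : ℝ :=
  ⨆ p : (t : T) × 𝒢.strategies t, ∑ e ∈ p.2.1, poissonCost 𝒢 e α

end Costs

end CongestionGame

end

/-! Each load `X_e^n` is a sum of independent Bernoulli variables with parameters at most `r^n`. The
Chen-Stein method puts its law within `r^n` of the Poisson law with the same mean, and two Poisson
laws are at distance at most the difference of their means (`IsMixed.tvDist_loadLaw_le`). It remains
to compare the expected equilibrium loads with the Wardrop loads.

The expected loads form an approximate Wardrop equilibrium for the demands `d^n`
(`IsBNE.isApproxWardrop`). The cost faced by a player is the expectation of `c_e(1 + ·)` under a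
Bernoulli sum, and it is replaced by `ĉ_e` in two moves. Restoring the omitted player shifts the
mean by at most `r^n`, which costs at most `ζ r^n`. Replacing the Bernoulli sum by the Poisson
variable of equal mean is controlled by second differences: an expectation depends on the law only
through its mean and its stop-loss transforms `E(W - j - 1)⁺`, weighted by `Δ²`. The laws of `∑
Bernoulli(u p_i) + Poisson(x(1 - u))` join the two at constant mean, and along this path the
stop-loss derivative is a combination of point probabilities, bounded by `x^j / j!` up to a factor
(`stopLoss_pois_sub_stopLoss_bernPoly`). The two errors combine to at most `2 Λ(r^n)` per resource.

The variational inequality behind Wardrop equilibria survives with error terms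
(`IsApproxWardrop.sum_sub_mul_sub_le`). As `ĉ_e' ≥ β`, it bounds `β (x_e - x'_e)²` by the
equilibrium errors plus the change of demand. This yields uniqueness of the loads and the two square
roots in the rate. Existence follows by compactness: the equilibrium flows have a convergent
subsequence, and its limit is a Wardrop equilibrium (`exists_isWardrop_of_tendsto`). -/

noncomputable section

namespace CongestionGame

/-! ### Poisson weights -/

/-- The probability that a Poisson variable with parameter `x` equals `k`. -/
def pois (x : ℝ) (k : ℕ) : ℝ := Real.exp (-x) * x ^ k / k.factorial

lemma pois_nonneg {x : ℝ} (hx : 0 ≤ x) (k : ℕ) : 0 ≤ pois x k := by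
  unfold pois; positivity

lemma pois_pos {x : ℝ} (hx : 0 < x) (k : ℕ) : 0 < pois x k := by
  unfold pois; positivity

lemma pois_zero_right (x : ℝ) : pois x 0 = Real.exp (-x) := by simp [pois]

lemma pois_zero_succ (k : ℕ) : pois 0 (k + 1) = 0 := by simp [pois]

lemma succ_mul_pois_succ (x : ℝ) (k : ℕ) : ((k : ℝ) + 1) * pois x (k + 1) = x * pois x k := by
  unfold pois
  rw [Nat.factorial_succ, pow_succ]
  push_cast
  field_simp

lemma hasSum_pois (x : ℝ) : HasSum (pois x) 1 := by
  have h := (NormedSpace.expSeries_div_hasSum_exp (x : ℝ)).mul_left (Real.exp (-x))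
  rw [← Real.exp_eq_exp_ℝ, ← Real.exp_add, neg_add_cancel, Real.exp_zero] at h
  exact h.congr_fun fun k => by rw [pois, mul_div_assoc]

lemma hasSum_mul_pois (x : ℝ) : HasSum (fun k : ℕ => (k : ℝ) * pois x k) x := by
  rw [← hasSum_nat_add_iff' 1]
  simp only [Nat.cast_add, Nat.cast_one, succ_mul_pois_succ, Finset.range_one,
    Finset.sum_singleton, Nat.cast_zero, zero_mul, sub_zero]
  simpa using (hasSum_pois x).mul_left x

lemma poisson_real_apply {x : ℝ} (hx : 0 ≤ x) (A : Set ℕ) :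
    (poisson x).real A = ∑' k, A.indicator (pois x) k := by
  have h := integral_poissonMeasure x.toNNReal (A.indicator (1 : ℕ → ℝ))
  rw [integral_indicator_one (MeasurableSet.of_discrete)] at h
  rw [poisson, h]
  congr 1
  ext k
  by_cases hk : k ∈ A <;> simp [hk, pois, Real.coe_toNNReal x hx]

lemma integrable_poisson_iff {x : ℝ} (hx : 0 ≤ x) {f : ℕ → ℝ} :
    Integrable f (poisson x) ↔ Summable fun k => pois x k * |f k| := by
  rw [poisson, integrable_poissonMeasure_iff, Real.coe_toNNReal x hx]
  rfl

lemma integral_poisson {x : ℝ} (hx : 0 ≤ x) (f : ℕ → ℝ) :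
    ∫ k, f k ∂poisson x = ∑' k, pois x k * f k := by
  rw [poisson, integral_poissonMeasure, Real.coe_toNNReal x hx]
  rfl

lemma hasDerivAt_pois_zero (x : ℝ) : HasDerivAt (fun x => pois x 0) (-pois x 0) x := by
  simp only [pois_zero_right]
  simpa using (hasDerivAt_neg x).exp

lemma hasDerivAt_pois_succ (k : ℕ) (x : ℝ) :
    HasDerivAt (fun x => pois x (k + 1)) (pois x k - pois x (k + 1)) x := by
  have h := (((hasDerivAt_neg x).exp).mul (hasDerivAt_pow (k + 1) x)).div_const
    ((k + 1).factorial : ℝ)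
  refine h.congr_deriv ?_
  unfold pois
  rw [Nat.factorial_succ]
  push_cast
  field_simp
  ring

/-- Tail probabilities of the Poisson law. -/
def poisTail (x : ℝ) (j : ℕ) : ℝ := 1 - ∑ k ∈ Finset.range (j + 1), pois x k

lemma hasSum_poisTail (x : ℝ) (j : ℕ) : HasSum (fun m => pois x (m + (j + 1))) (poisTail x j) :=
  (hasSum_nat_add_iff' (j + 1)).2 (hasSum_pois x)

lemma poisTail_nonneg {x : ℝ} (hx : 0 ≤ x) (j : ℕ) : 0 ≤ poisTail x j :=
  (hasSum_poisTail x j).nonneg fun _ => pois_nonneg hx _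

/-- Termwise comparison through `j! (m+1)! ≤ (m+j+1)!`. The factor `1 - exp (-x)` is kept because it
becomes the `e^α - 1` of `ζ`. -/
lemma poisTail_le {x : ℝ} (hx : 0 ≤ x) (j : ℕ) :
    poisTail x j ≤ x ^ j / j.factorial * (1 - Real.exp (-x)) := by
  have h0 : HasSum (fun m => pois x (m + 1)) (1 - Real.exp (-x)) := by
    simpa [poisTail, pois_zero_right] using hasSum_poisTail x 0
  refine hasSum_le (fun m => ?_) (hasSum_poisTail x j) (h0.mul_left _)
  have hfac : ((j.factorial : ℝ) * (m + 1).factorial) ≤ (m + (j + 1)).factorial := by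
    have := Nat.le_of_dvd (Nat.factorial_pos _) (Nat.factorial_mul_factorial_dvd_factorial_add j (m + 1))
    rw [show j + (m + 1) = m + (j + 1) by ring] at this
    exact_mod_cast this
  unfold pois
  calc Real.exp (-x) * x ^ (m + (j + 1)) / (m + (j + 1)).factorial
      ≤ Real.exp (-x) * x ^ (m + (j + 1)) / ((j.factorial : ℝ) * (m + 1).factorial) := by
        gcongr
    _ = _ := by field_simp; ring

/-! ### Stop-loss transforms -/

/-- `E(W - (j + 1))⁺` for a variable `W` with weights `w` and mean `m`. -/
def stopLoss (w : ℕ → ℝ) (m : ℝ) (j : ℕ) : ℝ :=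
  m - (j + 1) + ∑ k ∈ Finset.range (j + 1), ((j : ℝ) + 1 - k) * w k

/-- Uses `(k - (j+1))⁺ = k - (j+1) + (j+1-k)⁺`, with truncated subtraction on `ℕ` as positive part.
Thanks to the finite form of `stopLoss`, derivatives in a parameter involve only finitely many
weights. -/
lemma hasSum_stopLoss {w : ℕ → ℝ} {m : ℝ} (hw : HasSum w 1)
    (hm : HasSum (fun k : ℕ => (k : ℝ) * w k) m) (j : ℕ) :
    HasSum (fun k => w k * ((k - (j + 1) : ℕ) : ℝ)) (stopLoss w m j) := by
  have h3 : HasSum (fun k => if k ∈ Finset.range (j + 1) then ((j : ℝ) + 1 - k) * w k else 0)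
      (∑ k ∈ Finset.range (j + 1), ((j : ℝ) + 1 - k) * w k) := by
    rw [Finset.sum_congr rfl fun k hk => (if_pos hk).symm]
    exact hasSum_sum_of_ne_finset_zero fun k hk => if_neg hk
  have h := (hm.sub (hw.mul_left ((j : ℝ) + 1))).add h3
  rw [mul_one] at h
  refine h.congr_fun fun k => ?_
  by_cases hk : k < j + 1
  · have : k - (j + 1) = 0 := by omega
    simp [hk, this]; ring
  · have : j + 1 ≤ k := by omega
    simp only [Finset.mem_range, hk, if_false]
    push_cast [Nat.cast_sub this]
    ring

lemma stopLoss_nonneg {w : ℕ → ℝ} {m : ℝ} (h0 : ∀ k, 0 ≤ w k) (hw : HasSum w 1)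
    (hm : HasSum (fun k : ℕ => (k : ℝ) * w k) m) (j : ℕ) : 0 ≤ stopLoss w m j :=
  (hasSum_stopLoss hw hm j).nonneg fun k => mul_nonneg (h0 k) (Nat.cast_nonneg _)

/-- Discrete second-order Taylor formula, from summing differences twice. -/
lemma eq_sum_secondDiff (h : ℕ → ℝ) (k : ℕ) :
    h k = h 0 + k * (h 1 - h 0) +
      ∑ j ∈ Finset.range k, ((k - (j + 1) : ℕ) : ℝ) * secondDiff h j := by
  have hΔ : ∀ k, h (k + 1) - h k = h 1 - h 0 + ∑ j ∈ Finset.range k, secondDiff h j := by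
    intro k
    induction k with
    | zero => simp
    | succ k ih => rw [Finset.sum_range_succ, ← add_assoc, ← ih, secondDiff]; ring
  induction k with
  | zero => simp
  | succ k ih =>
    have hs : ∑ j ∈ Finset.range (k + 1), ((k + 1 - (j + 1) : ℕ) : ℝ) * secondDiff h j =
        ∑ j ∈ Finset.range k, ((k - (j + 1) : ℕ) : ℝ) * secondDiff h j +
          ∑ j ∈ Finset.range k, secondDiff h j := by
      rw [Finset.sum_range_succ, ← Finset.sum_add_distrib]
      simp only [Nat.sub_self, Nat.cast_zero, zero_mul, add_zero]
      refine Finset.sum_congr rfl fun j hj => ?_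
      have hj' : j + 1 ≤ k := Finset.mem_range.1 hj
      rw [show k + 1 - (j + 1) = (k - (j + 1)) + 1 by omega]
      push_cast
      ring
    rw [hs]
    push_cast
    linarith [hΔ k, ih]

lemma hasSum_secondDiff (h : ℕ → ℝ) (k : ℕ) :
    HasSum (fun j => ((k - (j + 1) : ℕ) : ℝ) * secondDiff h j)
      (h k - h 0 - k * (h 1 - h 0)) := by
  have : h k - h 0 - k * (h 1 - h 0) =
      ∑ j ∈ Finset.range k, ((k - (j + 1) : ℕ) : ℝ) * secondDiff h j := by
    linarith [eq_sum_secondDiff h k]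
  rw [this]
  refine hasSum_sum_of_ne_finset_zero fun j hj => ?_
  have : k - (j + 1) = 0 := by have := Finset.mem_range.not.1 hj; omega
  simp [this]

/-- Expansion of an expectation in terms of the stop-loss transforms. -/
lemma hasSum_mul_of_summable_stopLoss {w : ℕ → ℝ} {m : ℝ} (h0 : ∀ k, 0 ≤ w k) (hw : HasSum w 1)
    (hm : HasSum (fun k : ℕ => (k : ℝ) * w k) m) (h : ℕ → ℝ)
    (hf : Summable fun j => |secondDiff h j| * stopLoss w m j) :
    HasSum (fun k => w k * h k)
      (h 0 + m * (h 1 - h 0) + ∑' j, secondDiff h j * stopLoss w m j) := by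
  -- Fubini: summing over the values of `W` first gives stop-loss transforms, summing over `j` first
  -- gives the Taylor remainder of `h`.
  set F : ℕ × ℕ → ℝ := fun q => w q.2 * (((q.2 - (q.1 + 1) : ℕ) : ℝ) * secondDiff h q.1) with hF
  have hcol : ∀ j, HasSum (fun k => F (j, k)) (secondDiff h j * stopLoss w m j) := by
    intro j
    refine ((hasSum_stopLoss hw hm j).mul_left (secondDiff h j)).congr_fun fun k => ?_
    simp only [hF]; ring
  have hcolabs : ∀ j, HasSum (fun k => |F (j, k)|) (|secondDiff h j| * stopLoss w m j) := by
    intro j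
    refine ((hasSum_stopLoss hw hm j).mul_left |secondDiff h j|).congr_fun fun k => ?_
    simp only [hF, abs_mul, abs_of_nonneg (h0 k), Nat.abs_cast]; ring
  have hsum : Summable F := by
    rw [← summable_abs_iff, summable_prod_of_nonneg fun _ => abs_nonneg _]
    refine ⟨fun j => (hcolabs j).summable, hf.congr fun j => (hcolabs j).tsum_eq.symm⟩
  have h1 : HasSum F (∑' j, secondDiff h j * stopLoss w m j) := by
    have := hsum.hasSum
    rwa [hsum.tsum_prod' fun j => (hcol j).summable, tsum_congr fun j => (hcol j).tsum_eq] at this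
  have h2 : HasSum (fun k => w k * (h k - h 0 - k * (h 1 - h 0)))
      (∑' j, secondDiff h j * stopLoss w m j) :=
    ((Equiv.prodComm ℕ ℕ).hasSum_iff.2 h1).prod_fiberwise fun k => by
      simpa [hF] using (hasSum_secondDiff h k).mul_left (w k)
  have h3 := ((hw.mul_left (h 0)).add (hm.mul_left (h 1 - h 0))).add h2
  rw [mul_one, mul_comm (h 1 - h 0) m] at h3
  exact h3.congr_fun fun k => by ring

lemma stopLoss_pois_zero (j : ℕ) : stopLoss (pois 0) 0 j = 0 := by
  rw [stopLoss, Finset.sum_range_succ']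
  simp [pois_zero_succ, pois_zero_right]

lemma hasDerivAt_stopLoss_pois (j : ℕ) (x : ℝ) :
    HasDerivAt (fun x => stopLoss (pois x) x j) (poisTail x j) x := by
  have key : HasDerivAt (fun x => ∑ k ∈ Finset.range (j + 1), ((j : ℝ) + 1 - k) * pois x k)
      (∑ k ∈ Finset.range (j + 1), ((j : ℝ) + 1 - k) *
        (if k = 0 then -pois x 0 else pois x (k - 1) - pois x k)) x := by
    refine HasDerivAt.fun_sum fun k _ => HasDerivAt.const_mul _ ?_
    cases k with
    | zero => simpa using hasDerivAt_pois_zero x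
    | succ k => simpa using hasDerivAt_pois_succ k x
  have h := ((hasDerivAt_id x).sub_const ((j : ℝ) + 1)).add key
  refine h.congr_deriv ?_
  -- Summation by parts, stated for all partial sums so that induction applies; the boundary term
  -- vanishes at `n = j`.
  have : ∀ n ≤ j, ∑ k ∈ Finset.range (n + 1), ((j : ℝ) + 1 - k) *
        (if k = 0 then -pois x 0 else pois x (k - 1) - pois x k) =
      -∑ k ∈ Finset.range (n + 1), pois x k - (j - n) * pois x n := by
    intro n
    induction n with
    | zero => intro _; simp; ring
    | succ n ih =>
      intro hn
      rw [Finset.sum_range_succ, ih (by omega), Finset.sum_range_succ _ (n + 1)]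
      simp
      ring
  rw [this j le_rfl, poisTail]
  simp [sub_eq_add_neg]

lemma stopLoss_pois_sub_le {α x y : ℝ} (hx : 0 ≤ x) (hxy : x ≤ y) (hy : y ≤ α) (j : ℕ) :
    stopLoss (pois y) y j - stopLoss (pois x) x j ≤
      (α ^ j / j.factorial * (1 - Real.exp (-α))) * (y - x) := by
  have hd : ∀ z, HasDerivAt (fun x => stopLoss (pois x) x j) (poisTail z j) z :=
    hasDerivAt_stopLoss_pois j
  refine (convex_Icc 0 α).image_sub_le_mul_sub_of_deriv_le
    (fun z _ => (hd z).continuousAt.continuousWithinAt)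
    (fun z _ => (hd z).differentiableAt.differentiableWithinAt) (fun z hz => ?_)
    x ⟨hx, hxy.trans hy⟩ y ⟨hx.trans hxy, hy⟩ hxy
  rw [(hd z).deriv]
  have hz' := interior_subset hz
  refine (poisTail_le hz'.1 j).trans ?_
  have : Real.exp (-z) ≤ 1 := Real.exp_le_one_iff.2 (by linarith [hz'.1])
  have := hz'.1
  have := hz'.2
  have hα : 0 ≤ α := by linarith
  gcongr

lemma stopLoss_pois_mono {x y : ℝ} (hx : 0 ≤ x) (hxy : x ≤ y) (j : ℕ) :
    stopLoss (pois x) x j ≤ stopLoss (pois y) y j := by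
  have hd : ∀ z, HasDerivAt (fun x => stopLoss (pois x) x j) (poisTail z j) z :=
    hasDerivAt_stopLoss_pois j
  refine monotoneOn_of_deriv_nonneg (convex_Ici 0)
    (fun z _ => (hd z).continuousAt.continuousWithinAt)
    (fun z _ => (hd z).differentiableAt.differentiableWithinAt) (fun z hz => ?_) hx
    (hx.trans hxy) hxy
  rw [(hd z).deriv]
  exact poisTail_nonneg (interior_subset hz) j

/-! ### Total variation distance of two Poisson laws -/

lemma summable_indicator_pois (x : ℝ) (A : Set ℕ) : Summable (A.indicator (pois x)) :=
  (hasSum_pois x).summable.indicator A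

lemma tsum_indicator_pois_compl (x : ℝ) (A : Set ℕ) :
    ∑' k, Aᶜ.indicator (pois x) k = 1 - ∑' k, A.indicator (pois x) k := by
  rw [eq_sub_iff_add_eq, ← (summable_indicator_pois x _).tsum_add (summable_indicator_pois x _),
    ← (hasSum_pois x).tsum_eq]
  congr 1; ext k
  by_cases hk : k ∈ A <;> simp [hk]

lemma tsum_indicator_pois_nonneg {x : ℝ} (hx : 0 ≤ x) (A : Set ℕ) :
    0 ≤ ∑' k, A.indicator (pois x) k :=
  tsum_nonneg fun _ => Set.indicator_nonneg (fun _ _ => pois_nonneg hx _) _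

lemma tsum_indicator_pois_le_one {x : ℝ} (hx : 0 ≤ x) (A : Set ℕ) :
    ∑' k, A.indicator (pois x) k ≤ 1 := by
  linarith [tsum_indicator_pois_compl x A, tsum_indicator_pois_nonneg hx Aᶜ]

/-- A `Poisson(b)` variable is a `Poisson(a)` one plus an independent `Poisson(b - a)` one, which
vanishes with probability `exp (-(b - a)) ≥ 1 - (b - a)`; hence the pointwise domination of weights.
-/
lemma tsum_indicator_pois_sub_le {a b : ℝ} (ha : 0 ≤ a) (hab : a ≤ b) (A : Set ℕ) :
    ∑' k, A.indicator (pois a) k - ∑' k, A.indicator (pois b) k ≤ b - a := by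
  have h1 : Real.exp (-(b - a)) * ∑' k, A.indicator (pois a) k ≤ ∑' k, A.indicator (pois b) k := by
    rw [← tsum_mul_left]
    refine ((summable_indicator_pois a A).mul_left _).tsum_le_tsum (fun k => ?_)
      (summable_indicator_pois b A)
    by_cases hk : k ∈ A
    · simp only [hk, Set.indicator_of_mem]
      unfold pois
      rw [← mul_div_assoc, ← mul_assoc, ← Real.exp_add]
      rw [show -(b - a) + -a = -b by ring]
      gcongr
    · simp [hk]
  have h2 := Real.add_one_le_exp (-(b - a))
  have h3 := tsum_indicator_pois_le_one ha A
  have h4 := tsum_indicator_pois_nonneg ha A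
  nlinarith

lemma abs_tsum_indicator_pois_sub_le {a b : ℝ} (ha : 0 ≤ a) (hb : 0 ≤ b) (A : Set ℕ) :
    |∑' k, A.indicator (pois a) k - ∑' k, A.indicator (pois b) k| ≤ |a - b| := by
  wlog hab : a ≤ b generalizing a b
  · rw [abs_sub_comm, abs_sub_comm a]
    exact this hb ha (le_of_not_ge hab)
  rw [abs_of_nonpos (sub_nonpos.2 hab), abs_le]
  have h1 := tsum_indicator_pois_sub_le ha hab A
  have h2 := tsum_indicator_pois_sub_le ha hab Aᶜ
  rw [tsum_indicator_pois_compl, tsum_indicator_pois_compl] at h2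
  constructor <;> linarith

/-! ### Finitely supported weights as polynomials -/

open Polynomial in
/-- The pairing `∑ k, φ k * P.coeff k` of a function on `ℕ` with a polynomial. -/
def pairing (φ : ℕ → ℝ) : ℝ[X] →ₗ[ℝ] ℝ := Polynomial.lsum fun k => φ k • LinearMap.id

section Pairing

open Polynomial

lemma pairing_monomial (φ : ℕ → ℝ) (k : ℕ) (a : ℝ) : pairing φ (monomial k a) = φ k * a := by
  simp [pairing, Polynomial.lsum_apply, Polynomial.sum_monomial_index]

lemma hasSum_pairing (φ : ℕ → ℝ) (P : ℝ[X]) : HasSum (fun k => P.coeff k * φ k) (pairing φ P) := by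
  have h : pairing φ P = ∑ k ∈ P.support, P.coeff k * φ k := by
    simp [pairing, Polynomial.lsum_apply, Polynomial.sum_def, mul_comm]
  rw [h]
  exact hasSum_sum_of_ne_finset_zero fun k hk => by simp [Polynomial.notMem_support_iff.1 hk]

lemma pairing_mul_X (φ : ℕ → ℝ) (P : ℝ[X]) :
    pairing φ (P * X) = pairing (fun k => φ (k + 1)) P := by
  induction P using Polynomial.induction_on' with
  | add p q hp hq => rw [add_mul, map_add, map_add, hp, hq]
  | monomial k a => rw [Polynomial.monomial_mul_X, pairing_monomial, pairing_monomial]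

/-- Size-biasing in terms of generating polynomials; for Bernoulli sums the derivative expands over
the omitted variable. -/
lemma pairing_derivative (φ : ℕ → ℝ) (P : ℝ[X]) :
    pairing (fun k => k * φ k) P = pairing (fun k => φ (k + 1)) (derivative P) := by
  induction P using Polynomial.induction_on' with
  | add p q hp hq => rw [derivative_add, map_add, map_add, hp, hq]
  | monomial k a =>
    rw [derivative_monomial, pairing_monomial, pairing_monomial]
    cases k with
    | zero => simp
    | succ k => simp only [Nat.add_sub_cancel]; ring

lemma pairing_one (P : ℝ[X]) : pairing (fun _ => 1) P = P.eval 1 := by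
  induction P using Polynomial.induction_on' with
  | add p q hp hq => rw [map_add, eval_add, hp, hq]
  | monomial k a => simp [pairing_monomial]

lemma pairing_sub (φ ψ : ℕ → ℝ) (P : ℝ[X]) :
    pairing (fun k => φ k - ψ k) P = pairing φ P - pairing ψ P := by
  refine (hasSum_pairing _ P).unique ?_
  exact ((hasSum_pairing φ P).sub (hasSum_pairing ψ P)).congr_fun fun k => by ring

lemma pairing_const_mul (c : ℝ) (φ : ℕ → ℝ) (P : ℝ[X]) :
    pairing (fun k => c * φ k) P = c * pairing φ P := by
  refine (hasSum_pairing _ P).unique ?_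
  exact ((hasSum_pairing φ P).mul_left c).congr_fun fun k => by ring

lemma abs_pairing_le {P : ℝ[X]} (hP : ∀ k, 0 ≤ P.coeff k) {φ : ℕ → ℝ} {c : ℝ}
    (hφ : ∀ k, |φ k| ≤ c) : |pairing φ P| ≤ c * P.eval 1 := by
  have h1 := (hasSum_pairing (fun _ => 1) P).mul_left c
  rw [pairing_one] at h1
  rw [abs_le]
  constructor
  · refine hasSum_le (fun k => ?_) h1.neg (hasSum_pairing φ P)
    nlinarith [(abs_le.1 (hφ k)).1, hP k]
  · refine hasSum_le (fun k => ?_) (hasSum_pairing φ P) h1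
    nlinarith [(abs_le.1 (hφ k)).2, hP k]

end Pairing

/-! ### Generating polynomials of sums of independent Bernoulli variables -/

section BernPoly

open Polynomial

variable {ι : Type*}

/-- The generating polynomial of a sum of independent Bernoulli variables. -/
def bernPoly (p : ι → ℝ) (s : Finset ι) : ℝ[X] := ∏ i ∈ s, (C (1 - p i) + C (p i) * X)

lemma bernPoly_insert [DecidableEq ι] (p : ι → ℝ) {s : Finset ι} {i : ι} (hi : i ∉ s) :
    bernPoly p (insert i s) = bernPoly p s * (C (1 - p i) + C (p i) * X) := by
  rw [bernPoly, Finset.prod_insert hi, mul_comm]; rfl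

lemma bernPoly_erase_mul [DecidableEq ι] (p : ι → ℝ) {s : Finset ι} {i : ι} (hi : i ∈ s) :
    bernPoly p (s.erase i) * (C (1 - p i) + C (p i) * X) = bernPoly p s := by
  rw [← bernPoly_insert p (Finset.notMem_erase i s), Finset.insert_erase hi]

lemma coeff_mul_bern (P : ℝ[X]) (a b : ℝ) (k : ℕ) :
    (P * (C a + C b * X)).coeff (k + 1) = a * P.coeff (k + 1) + b * P.coeff k := by
  rw [mul_add, ← mul_assoc, coeff_add, coeff_mul_X, coeff_mul_C, coeff_mul_C]; ring

lemma coeff_bernPoly_nonneg {p : ι → ℝ} {s : Finset ι} (hp : ∀ i ∈ s, 0 ≤ p i)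
    (hp' : ∀ i ∈ s, p i ≤ 1) (k : ℕ) : 0 ≤ (bernPoly p s).coeff k := by
  classical
  induction s using Finset.induction_on generalizing k with
  | empty => simp only [bernPoly, Finset.prod_empty, coeff_one]; split_ifs <;> norm_num
  | insert i s hi ih =>
    have ih' := ih (fun j hj => hp j (Finset.mem_insert_of_mem hj))
      (fun j hj => hp' j (Finset.mem_insert_of_mem hj))
    have h0 := hp i (Finset.mem_insert_self i s)
    have h1 := hp' i (Finset.mem_insert_self i s)
    rw [bernPoly_insert p hi]
    cases k with
    | zero =>
      simp only [mul_coeff_zero, coeff_add, coeff_C_zero, coeff_X_zero, mul_zero, add_zero]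
      exact mul_nonneg (ih' 0) (by linarith)
    | succ k =>
      rw [coeff_mul_bern]
      exact add_nonneg (mul_nonneg (by linarith) (ih' _)) (mul_nonneg h0 (ih' _))

lemma eval_one_bernPoly (p : ι → ℝ) (s : Finset ι) : (bernPoly p s).eval 1 = 1 := by
  simp [bernPoly, eval_prod]

lemma derivative_bernPoly [DecidableEq ι] (p : ι → ℝ) (s : Finset ι) :
    derivative (bernPoly p s) = ∑ i ∈ s, p i • bernPoly p (s.erase i) := by
  rw [bernPoly, derivative_prod_finset]
  refine Finset.sum_congr rfl fun i _ => ?_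
  rw [derivative_add, derivative_C, zero_add, derivative_C_mul_X, smul_eq_C_mul, mul_comm]
  rfl

lemma hasSum_coeff_bernPoly (p : ι → ℝ) (s : Finset ι) :
    HasSum (fun k => (bernPoly p s).coeff k) 1 := by
  have := hasSum_pairing (fun _ => 1) (bernPoly p s)
  simpa [pairing_one, eval_one_bernPoly] using this

lemma hasSum_mul_coeff_bernPoly (p : ι → ℝ) (s : Finset ι) :
    HasSum (fun k : ℕ => (k : ℝ) * (bernPoly p s).coeff k) (∑ i ∈ s, p i) := by
  classical
  have h := hasSum_pairing (fun k : ℕ => (k : ℝ) * 1) (bernPoly p s)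
  rw [pairing_derivative (fun _ => 1), pairing_one, derivative_bernPoly, eval_finsetSum] at h
  simp only [eval_smul, eval_one_bernPoly, smul_eq_mul, mul_one] at h
  exact h.congr_fun fun k => mul_comm _ _

end BernPoly

/-! ### The Stein equation for the Poisson law -/

/-- The solution of the Stein equation for the indicator of `A`. -/
def stein (x : ℝ) (A : Set ℕ) : ℕ → ℝ
  | 0 => 0
  | k + 1 => (∑ m ∈ Finset.range (k + 1), A.indicator (pois x) m -
      (∑' m, A.indicator (pois x) m) * ∑ m ∈ Finset.range (k + 1), pois x m) / (x * pois x k)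

/-- The value of `stein` at `0` is immaterial, since it enters only with the factor `k = 0`. -/
lemma stein_equation {x : ℝ} (hx : 0 < x) (A : Set ℕ) (k : ℕ) :
    x * stein x A (k + 1) - k * stein x A k =
      A.indicator (fun _ => 1) k - ∑' m, A.indicator (pois x) m := by
  have hind : ∀ k, A.indicator (pois x) k = A.indicator (fun _ => (1 : ℝ)) k * pois x k := by
    intro k; by_cases hk : k ∈ A <;> simp [hk]
  cases k with
  | zero =>
    have := pois_pos hx 0
    simp only [stein, zero_add, Finset.range_one, Finset.sum_singleton, hind 0]
    field_simp
    simp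
  | succ k =>
    have h1 := pois_pos hx k
    have h2 := pois_pos hx (k + 1)
    have h3 := succ_mul_pois_succ x k
    simp only [stein]
    rw [← h3, Finset.sum_range_succ _ (k + 1), Finset.sum_range_succ _ (k + 1), hind (k + 1)]
    push_cast
    field_simp
    ring

lemma stein_compl {x : ℝ} (A : Set ℕ) (k : ℕ) : stein x Aᶜ k = -stein x A k := by
  cases k with
  | zero => simp [stein]
  | succ k =>
    have : ∑ m ∈ Finset.range (k + 1), Aᶜ.indicator (pois x) m =
        ∑ m ∈ Finset.range (k + 1), pois x m -
          ∑ m ∈ Finset.range (k + 1), A.indicator (pois x) m := by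
      rw [← Finset.sum_sub_distrib]
      refine Finset.sum_congr rfl fun m _ => ?_
      by_cases hm : m ∈ A <;> simp [hm]
    simp only [stein, tsum_indicator_pois_compl, this]
    ring

/-- Log-concavity: successive ratios `x / (k+1)` of the weights decrease, so the cumulative sum
divided by the last weight increases. -/
lemma pois_succ_mul_sum_le {x : ℝ} (hx : 0 < x) (k : ℕ) :
    pois x (k + 1) * ∑ m ∈ Finset.range (k + 1), pois x m ≤
      pois x k * ∑ m ∈ Finset.range (k + 2), pois x m := by
  rw [Finset.sum_range_succ' _ (k + 1), Finset.mul_sum, mul_add, Finset.mul_sum]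
  have h0 := pois_pos hx k
  refine le_add_of_le_of_nonneg (Finset.sum_le_sum fun m hm => ?_)
    (mul_nonneg h0.le (pois_nonneg hx.le 0))
  have hm' : (m : ℝ) + 1 ≤ k + 1 := by exact_mod_cast Finset.mem_range.1 hm
  have h1 := succ_mul_pois_succ x k
  have h2 := succ_mul_pois_succ x m
  have h3 : ((k : ℝ) + 1) * (pois x (k + 1) * pois x m) =
      (m + 1) * (pois x k * pois x (m + 1)) := by
    calc _ = (((k : ℝ) + 1) * pois x (k + 1)) * pois x m := by ring
      _ = pois x k * (x * pois x m) := by rw [h1]; ring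
      _ = _ := by rw [← h2]; ring
  have h4 : 0 ≤ pois x k * pois x (m + 1) := mul_nonneg h0.le (pois_nonneg hx.le _)
  have h5 : ((k : ℝ) + 1) * (pois x (k + 1) * pois x m) ≤
      (k + 1) * (pois x k * pois x (m + 1)) := by rw [h3]; gcongr
  exact le_of_mul_le_mul_left h5 (by positivity)

/-- The same log-concavity for upper tails: tail divided by weight decreases. -/
lemma pois_mul_poisTail_le {x : ℝ} (hx : 0 < x) (k : ℕ) :
    pois x k * poisTail x (k + 1) ≤ pois x (k + 1) * poisTail x k := by
  refine hasSum_le (fun m => ?_) ((hasSum_poisTail x (k + 1)).mul_left _)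
    ((hasSum_poisTail x k).mul_left _)
  have h1 := succ_mul_pois_succ x k
  have h2 := succ_mul_pois_succ x (m + (k + 1))
  rw [show m + (k + 1) + 1 = m + (k + 1 + 1) by ring] at h2
  push_cast at h2
  have h3 : ((m : ℝ) + (k + 1) + 1) * (pois x k * pois x (m + (k + 1 + 1))) =
      (k + 1) * (pois x (k + 1) * pois x (m + (k + 1))) := by
    calc _ = pois x k * (((m : ℝ) + (k + 1) + 1) * pois x (m + (k + 1 + 1))) := by ring
      _ = (x * pois x k) * pois x (m + (k + 1)) := by rw [h2]; ring
      _ = _ := by rw [← h1]; ring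
  have h4 : 0 ≤ pois x (k + 1) * pois x (m + (k + 1)) :=
    mul_nonneg (pois_nonneg hx.le _) (pois_nonneg hx.le _)
  have h5 : ((m : ℝ) + (k + 1) + 1) * (pois x k * pois x (m + (k + 1 + 1))) ≤
      ((m : ℝ) + (k + 1) + 1) * (pois x (k + 1) * pois x (m + (k + 1))) := by
    rw [h3]
    refine mul_le_mul_of_nonneg_right ?_ h4
    have : (0 : ℝ) ≤ m := m.cast_nonneg
    linarith
  exact le_of_mul_le_mul_left h5 (by positivity)

/-- The increment is additive in `A`. Points up to `k` and points beyond `k + 1` contribute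
nonpositively by the two monotonicity lemmas above (`e1`, `e2`), so only the point `k + 1` can
contribute positively (`e3`, `e4`). The number `θ` records whether it lies in `A`. -/
lemma stein_sub_le {x : ℝ} (hx : 0 < x) (A : Set ℕ) (k : ℕ) :
    stein x A (k + 2) - stein x A (k + 1) ≤ 1 / x := by
  obtain ⟨θ, hθ0, hθ1, hθ⟩ : ∃ θ : ℝ, 0 ≤ θ ∧ θ ≤ 1 ∧
      A.indicator (pois x) (k + 1) = θ * pois x (k + 1) := by
    by_cases hk : k + 1 ∈ A
    · exact ⟨1, by norm_num, le_rfl, by simp [hk]⟩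
    · exact ⟨0, le_rfl, by norm_num, by simp [hk]⟩
  have hi0 : ∀ m, 0 ≤ A.indicator (pois x) m := fun m =>
    Set.indicator_nonneg (fun _ _ => pois_nonneg hx.le _) _
  have hb : ∑ m ∈ Finset.range (k + 2), A.indicator (pois x) m ≤ ∑' m, A.indicator (pois x) m :=
    (summable_indicator_pois x A).sum_le_tsum _ fun m _ => hi0 m
  have ha : 0 ≤ ∑ m ∈ Finset.range (k + 1), A.indicator (pois x) m :=
    Finset.sum_nonneg fun m _ => hi0 m
  have f1 := pois_succ_mul_sum_le hx k
  have f2 := pois_mul_poisTail_le hx k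
  have q1 := pois_pos hx k
  have q2 := pois_pos hx (k + 1)
  simp only [stein, poisTail] at *
  rw [Finset.sum_range_succ _ (k + 1)] at *
  rw [Finset.sum_range_succ (pois x) (k + 1)] at *
  rw [hθ] at *
  generalize ∑ m ∈ Finset.range (k + 1), A.indicator (pois x) m = a at *
  generalize ∑ m ∈ Finset.range (k + 1), pois x m = F at *
  generalize ∑' m, A.indicator (pois x) m = PA at *
  generalize pois x (k + 1) = π at *
  generalize pois x k = π' at *
  rw [div_sub_div _ _ (by positivity) (by positivity), div_le_div_iff₀ (by positivity) hx]
  have e1 : a * (π' * (1 - (F + π)) - π * (1 - F)) ≤ 0 :=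
    mul_nonpos_of_nonneg_of_nonpos ha (by linarith)
  have e2 : (PA - a - θ * π) * (π * F - π' * (F + π)) ≤ 0 :=
    mul_nonpos_of_nonneg_of_nonpos (by linarith) (by linarith)
  have e3 : θ * π * (π' * (1 - (F + π)) + π * F) ≤ θ * π * π' :=
    mul_le_mul_of_nonneg_left (by linarith) (by positivity)
  have e4 : θ * (π * π') ≤ 1 * (π * π') := mul_le_mul_of_nonneg_right hθ1 (by positivity)
  have key : (a + θ * π - PA * (F + π)) * π' - π * (a - PA * F) ≤ π * π' := by
    nlinarith
  calc _ = ((a + θ * π - PA * (F + π)) * π' - π * (a - PA * F)) * (x * x) := by ring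
    _ ≤ (π * π') * (x * x) := by gcongr
    _ = _ := by ring

/-- Passing to the complement changes the sign of the Stein solution, so the one-sided bound for all
sets is two-sided. -/
lemma abs_stein_sub_le {x : ℝ} (hx : 0 < x) (A : Set ℕ) (k : ℕ) :
    |stein x A (k + 2) - stein x A (k + 1)| ≤ 1 / x := by
  have h1 := stein_sub_le hx A k
  have h2 := stein_sub_le hx Aᶜ k
  rw [stein_compl, stein_compl] at h2
  rw [abs_le]
  constructor <;> linarith

/-- **Poisson approximation** of a sum of independent Bernoulli variables in total variation. -/
lemma abs_pairing_indicator_bernPoly_sub_le {ι : Type*} {p : ι → ℝ} {s : Finset ι} {r : ℝ}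
    (hp : ∀ i ∈ s, 0 ≤ p i) (hp' : ∀ i ∈ s, p i ≤ 1) (hr : ∀ i ∈ s, p i ≤ r) (hr0 : 0 ≤ r)
    (A : Set ℕ) :
    |pairing (A.indicator fun _ => 1) (bernPoly p s) -
      ∑' k, A.indicator (pois (∑ i ∈ s, p i)) k| ≤ r := by
  classical
  set x := ∑ i ∈ s, p i with hx
  -- Mean zero is separate because the Stein solution divides by `x`; both laws are then the point
  -- mass at `0`.
  rcases (Finset.sum_nonneg hp).eq_or_lt with h0 | hpos
  · have hz : ∀ i ∈ s, p i = 0 := (Finset.sum_eq_zero_iff_of_nonneg hp).1 h0.symm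
    have hP : bernPoly p s = 1 := by
      refine Finset.prod_eq_one fun i hi => by simp [hz i hi]
    rw [hP, ← Polynomial.monomial_zero_one, pairing_monomial, hx, ← h0]
    rw [tsum_eq_single 0]
    · by_cases hk : 0 ∈ A <;> simp [hk, pois_zero_right, hr0]
    · intro k hk
      obtain ⟨k, rfl⟩ := Nat.exists_eq_succ_of_ne_zero hk
      by_cases hk : k + 1 ∈ A <;> simp [hk, pois_zero_succ]
  rw [← hx] at hpos
  set g := stein x A
  -- Chen-Stein identity: with `W_i` the sum without its `i`-th variable, `E[W g(W)] = ∑ p_i E[g(W_i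
  -- + 1)]`. Splitting `x E[g(W + 1)]` according to the `i`-th variable leaves only terms in `p_i²`.
  have h1 : pairing (A.indicator fun _ => 1) (bernPoly p s) -
      ∑' k, A.indicator (pois x) k =
      ∑ i ∈ s, p i ^ 2 * pairing (fun k => g (k + 2) - g (k + 1)) (bernPoly p (s.erase i)) := by
    have e1 : pairing (A.indicator fun _ => 1) (bernPoly p s) - ∑' k, A.indicator (pois x) k =
        pairing (fun k => x * g (k + 1) - k * g k) (bernPoly p s) := by
      have : (fun k : ℕ => x * g (k + 1) - k * g k) =
          fun k => A.indicator (fun _ => 1) k - (∑' m, A.indicator (pois x) m) * 1 := by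
        ext k; rw [stein_equation hpos, mul_one]
      rw [this, pairing_sub, pairing_const_mul, pairing_one, eval_one_bernPoly, mul_one]
    rw [e1, pairing_sub, pairing_const_mul, pairing_derivative, derivative_bernPoly, map_sum, hx,
      Finset.sum_mul, ← Finset.sum_sub_distrib]
    refine Finset.sum_congr rfl fun i hi => ?_
    rw [map_smul, smul_eq_mul, ← bernPoly_erase_mul p hi, mul_add, ← mul_assoc, map_add,
      pairing_mul_X, mul_comm _ (Polynomial.C _), mul_comm _ (Polynomial.C _),
      ← Polynomial.smul_eq_C_mul, ← Polynomial.smul_eq_C_mul, map_smul, map_smul, pairing_sub,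
      smul_eq_mul, smul_eq_mul]
    ring
  rw [h1]
  have h2 : ∀ i ∈ s, |p i ^ 2 * pairing (fun k => g (k + 2) - g (k + 1))
      (bernPoly p (s.erase i))| ≤ r * p i * (1 / x) := by
    intro i hi
    have hb := abs_pairing_le (P := bernPoly p (s.erase i))
      (coeff_bernPoly_nonneg (fun j hj => hp j (Finset.mem_of_mem_erase hj))
        (fun j hj => hp' j (Finset.mem_of_mem_erase hj))) (abs_stein_sub_le hpos A)
    rw [eval_one_bernPoly, mul_one] at hb
    rw [abs_mul, abs_of_nonneg (sq_nonneg _), pow_two]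
    have := hp i hi
    have := hr i hi
    gcongr
  calc _ ≤ ∑ i ∈ s, r * p i * (1 / x) :=
        (Finset.abs_sum_le_sum_abs _ _).trans (Finset.sum_le_sum h2)
    _ = r := by
        rw [← Finset.sum_mul, ← Finset.mul_sum, ← hx]
        field_simp

/-! ### Coefficientwise differentiation of power series -/

open PowerSeries in
/-- `F` is differentiable at `u`, coefficient by coefficient, with derivative `F'`. -/
def HasCoeffDerivAt (F : ℝ → ℝ⟦X⟧) (F' : ℝ⟦X⟧) (u : ℝ) : Prop :=
  ∀ k, HasDerivAt (fun u => PowerSeries.coeff k (F u)) (PowerSeries.coeff k F') u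

section Series

open PowerSeries

lemma HasCoeffDerivAt.mul {F G : ℝ → ℝ⟦X⟧} {F' G' : ℝ⟦X⟧} {u : ℝ} (hF : HasCoeffDerivAt F F' u)
    (hG : HasCoeffDerivAt G G' u) :
    HasCoeffDerivAt (fun u => F u * G u) (F' * G u + F u * G') u := by
  intro k
  simp only [map_add, coeff_mul, ← Finset.sum_add_distrib]
  exact HasDerivAt.fun_sum fun q _ => (hF q.1).mul (hG q.2)

/-- The generating series of the Poisson law. -/
def poisSeries (x : ℝ) : ℝ⟦X⟧ := PowerSeries.mk (pois x)

lemma hasCoeffDerivAt_poisSeries (x : ℝ) :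
    HasCoeffDerivAt poisSeries ((X - 1) * poisSeries x) x := by
  intro k
  rw [sub_mul, one_mul, map_sub]
  cases k with
  | zero => simpa [poisSeries] using hasDerivAt_pois_zero x
  | succ k =>
    simpa [poisSeries, coeff_succ_X_mul] using hasDerivAt_pois_succ k x

lemma hasCoeffDerivAt_poisSeries_one_sub (x u : ℝ) :
    HasCoeffDerivAt (fun u => poisSeries (x * (1 - u)))
      (-x • ((X - 1) * poisSeries (x * (1 - u)))) u := by
  intro k
  have h1 : HasDerivAt (fun u => x * (1 - u)) (-x) u := by
    simpa using ((hasDerivAt_id u).const_sub 1).const_mul x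
  have h2 := (hasCoeffDerivAt_poisSeries (x * (1 - u)) k).comp u h1
  rw [map_smul, smul_eq_mul, mul_comm]
  exact h2

lemma derivative_poisSeries (x : ℝ) :
    PowerSeries.derivative ℝ (poisSeries x) = x • poisSeries x := by
  ext k
  rw [coeff_derivative, map_smul, poisSeries, coeff_mk, coeff_mk, mul_comm, succ_mul_pois_succ,
    smul_eq_mul]

variable {ι : Type*}

/-- The generating series of a sum of independent Bernoulli variables. -/
def bernSeries (p : ι → ℝ) (s : Finset ι) : ℝ⟦X⟧ := (bernPoly p s : Polynomial ℝ)

lemma bernSeries_insert [DecidableEq ι] (p : ι → ℝ) {s : Finset ι} {i : ι} (hi : i ∉ s) :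
    bernSeries p (insert i s) = bernSeries p s * (1 + p i • (X - 1)) := by
  rw [bernSeries, bernPoly_insert p hi, Polynomial.coe_mul]
  congr 1
  ext k
  simp only [Polynomial.coeff_coe, map_add, map_smul, map_sub, Polynomial.coeff_add,
    Polynomial.coeff_C_mul, Polynomial.coeff_X, coeff_one, coeff_X,
    smul_eq_mul]
  rcases k with _ | _ | k <;> simp [Polynomial.coeff_one, Polynomial.coeff_C]
  ring

lemma bernSeries_erase_mul [DecidableEq ι] (p : ι → ℝ) {s : Finset ι} {i : ι} (hi : i ∈ s) :
    bernSeries p (s.erase i) * (1 + p i • (X - 1)) = bernSeries p s := by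
  rw [← bernSeries_insert p (Finset.notMem_erase i s), Finset.insert_erase hi]

lemma hasCoeffDerivAt_bernSeries [DecidableEq ι] (p : ι → ℝ) (s : Finset ι) (u : ℝ) :
    HasCoeffDerivAt (fun u => bernSeries (u • p) s)
      (∑ i ∈ s, p i • ((X - 1) * bernSeries (u • p) (s.erase i))) u := by
  induction s using Finset.induction_on with
  | empty =>
    intro k
    simpa [bernSeries, bernPoly] using hasDerivAt_const u _
  | insert i s hi ih =>
    have h1 : HasCoeffDerivAt (fun u => 1 + (u • p) i • (X - 1 : ℝ⟦X⟧)) (p i • (X - 1)) u := by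
      intro k
      simp only [map_add, map_smul, Pi.smul_apply, smul_eq_mul]
      have := (((hasDerivAt_id u).mul_const (p i)).mul_const
        (coeff k (X - 1 : ℝ⟦X⟧))).const_add (coeff k (1 : ℝ⟦X⟧))
      rwa [one_mul] at this
    have h2 := ih.mul h1
    simp only [← bernSeries_insert _ hi] at h2
    convert! h2 using 1
    rw [Finset.sum_insert hi, Finset.erase_insert hi, add_comm, Finset.sum_mul]
    congr 1
    · refine Finset.sum_congr rfl fun j hj => ?_
      have hij : i ≠ j := fun h => hi (h ▸ hj)
      rw [Finset.erase_insert_of_ne hij,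
        bernSeries_insert _ fun h => hi (Finset.mem_of_mem_erase h), smul_mul_assoc, mul_assoc]
    · rw [mul_smul_comm, mul_comm]

/-! ### Interpolation between a Bernoulli sum and a Poisson variable of equal mean -/

/-- The generating series of a sum of independent Bernoulli variables and an independent Poisson
variable. -/
def mixSeries (p : ι → ℝ) (s : Finset ι) (x : ℝ) : ℝ⟦X⟧ := bernSeries p s * poisSeries x

/-- The Bernoulli factors contribute `p_i (X - 1)` times the product without `i`, the Poisson factor
`-p_i (X - 1)` times the full product. The difference of these products is `-u p_i (X - 1)` times
the product without `i`, whence a second factor `1 - X`. -/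
lemma hasCoeffDerivAt_mixSeries [DecidableEq ι] (p : ι → ℝ) (s : Finset ι) (u : ℝ) :
    HasCoeffDerivAt (fun u => mixSeries (u • p) s ((∑ i ∈ s, p i) * (1 - u)))
      ((1 - X) * ((1 - X) * -(u • ∑ i ∈ s, p i ^ 2 •
        mixSeries (u • p) (s.erase i) ((∑ i ∈ s, p i) * (1 - u))))) u := by
  have h := (hasCoeffDerivAt_bernSeries p s u).mul
    (hasCoeffDerivAt_poisSeries_one_sub (∑ i ∈ s, p i) u)
  convert! h using 1
  simp only [mixSeries]
  generalize poisSeries ((∑ i ∈ s, p i) * (1 - u)) = Y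
  rw [neg_smul, Finset.sum_smul, Finset.sum_mul, ← Finset.sum_neg_distrib, Finset.mul_sum,
    ← Finset.sum_add_distrib, Finset.smul_sum, ← Finset.sum_neg_distrib, Finset.mul_sum,
    Finset.mul_sum]
  refine Finset.sum_congr rfl fun i hi => ?_
  rw [← bernSeries_erase_mul (u • p) hi]
  simp only [PowerSeries.smul_eq_C_mul, Pi.smul_apply, smul_eq_mul, map_mul, map_pow]
  ring

lemma sum_coeff_one_sub_X_mul (G : ℝ⟦X⟧) (k : ℕ) :
    ∑ m ∈ Finset.range (k + 1), coeff m ((1 - X) * G) = coeff k G := by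
  induction k with
  | zero => simp [sub_mul]
  | succ k ih =>
    rw [Finset.sum_range_succ, ih, sub_mul, one_mul, map_sub, coeff_succ_X_mul]
    ring

/-- The stop-loss weights `j + 1 - k` amount to summing twice, which undoes two multiplications by
`1 - X`. Stop-loss derivatives along the interpolation are therefore point probabilities. -/
lemma sum_mul_coeff_one_sub_X_mul (G : ℝ⟦X⟧) (j : ℕ) :
    ∑ k ∈ Finset.range (j + 1), ((j : ℝ) + 1 - k) * coeff k ((1 - X) * ((1 - X) * G)) =
      coeff j G := by
  have h : ∀ (c : ℕ → ℝ) (j : ℕ), ∑ k ∈ Finset.range (j + 1), ((j : ℝ) + 1 - k) * c k =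
      ∑ k ∈ Finset.range (j + 1), ∑ m ∈ Finset.range (k + 1), c m := by
    intro c j
    induction j with
    | zero => simp
    | succ j ih =>
      rw [Finset.sum_range_succ (fun k => ∑ m ∈ Finset.range (k + 1), c m) (j + 1), ← ih,
        Finset.sum_range_succ _ (j + 1), Finset.sum_range_succ c (j + 1), ← add_assoc, ← Finset.sum_add_distrib]
      congr 1
      · refine Finset.sum_congr rfl fun k _ => ?_
        push_cast; ring
      · push_cast; ring
  rw [h, Finset.sum_congr rfl fun k _ => sum_coeff_one_sub_X_mul _ k, sum_coeff_one_sub_X_mul]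

lemma hasDerivAt_stopLoss_mixSeries [DecidableEq ι] (p : ι → ℝ) (s : Finset ι) (j : ℕ) (u : ℝ) :
    HasDerivAt (fun u => stopLoss (fun k => coeff k
        (mixSeries (u • p) s ((∑ i ∈ s, p i) * (1 - u)))) (∑ i ∈ s, p i) j)
      (-(u * ∑ i ∈ s, p i ^ 2 *
        coeff j (mixSeries (u • p) (s.erase i) ((∑ i ∈ s, p i) * (1 - u))))) u := by
  have h : HasDerivAt (fun u => stopLoss (fun k => coeff k
        (mixSeries (u • p) s ((∑ i ∈ s, p i) * (1 - u)))) (∑ i ∈ s, p i) j) _ u :=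
    (HasDerivAt.fun_sum fun k _ =>
      (hasCoeffDerivAt_mixSeries p s u k).const_mul ((j : ℝ) + 1 - k)).const_add _
  rw [sum_mul_coeff_one_sub_X_mul] at h
  simpa using h

/-! ### Bounds on point probabilities -/

lemma coeff_mixSeries_nonneg {p : ι → ℝ} {s : Finset ι} {x : ℝ} (hp : ∀ i ∈ s, 0 ≤ p i)
    (hp' : ∀ i ∈ s, p i ≤ 1) (hx : 0 ≤ x) (k : ℕ) : 0 ≤ coeff k (mixSeries p s x) := by
  rw [mixSeries, coeff_mul]
  refine Finset.sum_nonneg fun q _ => mul_nonneg ?_ ?_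
  · rw [bernSeries, Polynomial.coeff_coe]; exact coeff_bernPoly_nonneg hp hp' _
  · rw [poisSeries, coeff_mk]; exact pois_nonneg hx _

lemma pois_le_one {x : ℝ} (hx : 0 ≤ x) (k : ℕ) : pois x k ≤ 1 :=
  le_hasSum (hasSum_pois x) k fun _ _ => pois_nonneg hx _

lemma coeff_mixSeries_le_one {p : ι → ℝ} {s : Finset ι} {x : ℝ} (hp : ∀ i ∈ s, 0 ≤ p i)
    (hp' : ∀ i ∈ s, p i ≤ 1) (hx : 0 ≤ x) (k : ℕ) : coeff k (mixSeries p s x) ≤ 1 := by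
  rw [mixSeries, coeff_mul,
    Finset.Nat.sum_antidiagonal_eq_sum_range_succ
      (fun a b => coeff a (bernSeries p s) * coeff b (poisSeries x))]
  simp only [bernSeries, Polynomial.coeff_coe, poisSeries, coeff_mk]
  calc _ ≤ ∑ a ∈ Finset.range (k + 1), (bernPoly p s).coeff a :=
        Finset.sum_le_sum fun a _ => mul_le_of_le_one_right
          (coeff_bernPoly_nonneg hp hp' a) (pois_le_one hx _)
    _ ≤ 1 := sum_le_hasSum _ (fun a _ => coeff_bernPoly_nonneg hp hp' a)
        (hasSum_coeff_bernPoly p s)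

/-- Coefficients of the derivative of the generating series, by the Leibniz rule. -/
lemma succ_mul_coeff_mixSeries [DecidableEq ι] (p : ι → ℝ) (s : Finset ι) (x : ℝ) (k : ℕ) :
    ((k : ℝ) + 1) * coeff (k + 1) (mixSeries p s x) =
      ∑ i ∈ s, p i * coeff k (mixSeries p (s.erase i) x) + x * coeff k (mixSeries p s x) := by
  have h : PowerSeries.derivative ℝ (mixSeries p s x) =
      ∑ i ∈ s, p i • mixSeries p (s.erase i) x + x • mixSeries p s x := by
    simp only [mixSeries]
    rw [Derivation.leibniz, derivative_poisSeries, bernSeries, derivative_coe,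
      derivative_bernPoly, smul_eq_mul, smul_eq_mul, mul_smul_comm, add_comm, mul_comm]
    congr 1
    rw [← Polynomial.coeToPowerSeries.ringHom_apply, map_sum, Finset.sum_mul]
    refine Finset.sum_congr rfl fun i _ => ?_
    rw [Polynomial.coeToPowerSeries.ringHom_apply, Polynomial.coe_smul, smul_mul_assoc]
    rfl
  have h2 := congrArg (coeff k) h
  rw [coeff_derivative, mul_comm] at h2
  simpa using h2

/-- Each use of the recursion costs one factor of the mean, since omitting a variable only lowers
it. The starting index `n` is free: both `n = 0` and `n = 1` are needed later. -/
lemma coeff_mixSeries_mul_factorial_le {p : ι → ℝ} {s : Finset ι} {x : ℝ}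
    (hp : ∀ i ∈ s, 0 ≤ p i) (hp' : ∀ i ∈ s, p i ≤ 1) (hx : 0 ≤ x) (n k : ℕ) :
    coeff (n + k) (mixSeries p s x) * (n + k).factorial ≤
      (∑ i ∈ s, p i + x) ^ k * n.factorial := by
  classical
  induction k generalizing s with
  | zero =>
    simp only [add_zero, pow_zero]
    exact mul_le_mul_of_nonneg_right (coeff_mixSeries_le_one hp hp' hx n) (by positivity)
  | succ k ih =>
    have hS : 0 ≤ ∑ i ∈ s, p i := Finset.sum_nonneg hp
    have h1 : ∀ i ∈ s, coeff (n + k) (mixSeries p (s.erase i) x) * (n + k).factorial ≤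
        (∑ i ∈ s, p i + x) ^ k * n.factorial := by
      intro i hi
      refine (ih (fun j hj => hp j (Finset.mem_of_mem_erase hj))
        (fun j hj => hp' j (Finset.mem_of_mem_erase hj))).trans ?_
      have h2 : ∑ j ∈ s.erase i, p j ≤ ∑ j ∈ s, p j :=
        Finset.sum_le_sum_of_subset_of_nonneg (Finset.erase_subset _ _) fun j hj _ => hp j hj
      have h3 : 0 ≤ ∑ j ∈ s.erase i, p j :=
        Finset.sum_nonneg fun j hj => hp j (Finset.mem_of_mem_erase hj)
      gcongr
    have h2 := ih hp hp'
    have h3 := succ_mul_coeff_mixSeries p s x (n + k)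
    calc coeff (n + (k + 1)) (mixSeries p s x) * (n + (k + 1)).factorial
        = (((n + k : ℕ) : ℝ) + 1) * coeff (n + k + 1) (mixSeries p s x) * (n + k).factorial := by
          rw [← add_assoc, Nat.factorial_succ]; push_cast; ring
      _ = ∑ i ∈ s, p i * (coeff (n + k) (mixSeries p (s.erase i) x) * (n + k).factorial) +
          x * (coeff (n + k) (mixSeries p s x) * (n + k).factorial) := by
          rw [h3, add_mul, Finset.sum_mul]
          simp only [mul_assoc]
      _ ≤ ∑ i ∈ s, p i * ((∑ i ∈ s, p i + x) ^ k * n.factorial) +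
          x * ((∑ i ∈ s, p i + x) ^ k * n.factorial) := by
          refine add_le_add (Finset.sum_le_sum fun i hi => ?_) ?_
          · exact mul_le_mul_of_nonneg_left (h1 i hi) (hp i hi)
          · exact mul_le_mul_of_nonneg_left h2 hx
      _ = _ := by rw [← Finset.sum_mul]; ring

lemma coeff_zero_mixSeries_le {p : ι → ℝ} {s : Finset ι} {x : ℝ} (hp' : ∀ i ∈ s, p i ≤ 1) :
    coeff 0 (mixSeries p s x) ≤ Real.exp (-(∑ i ∈ s, p i + x)) := by
  have h0 : coeff 0 (mixSeries p s x) = (∏ i ∈ s, (1 - p i)) * Real.exp (-x) := by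
    simp [mixSeries, coeff_mul, bernSeries, poisSeries, pois_zero_right, bernPoly,
      Polynomial.coeff_zero_prod]
  rw [h0, neg_add, Real.exp_add, ← Finset.sum_neg_distrib, Real.exp_sum]
  refine mul_le_mul_of_nonneg_right (Finset.prod_le_prod (fun i hi => ?_) fun i hi => ?_)
    (Real.exp_nonneg _)
  · linarith [hp' i hi]
  · linarith [Real.add_one_le_exp (-p i)]

lemma mul_coeff_mixSeries_erase_le [DecidableEq ι] {p : ι → ℝ} {s : Finset ι}
    (hp : ∀ i ∈ s, 0 ≤ p i) (hp' : ∀ i ∈ s, p i ≤ 1) {u : ℝ} (hu : u ∈ Set.Icc (0 : ℝ) 1)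
    {i : ι} (hi : i ∈ s) (j : ℕ) :
    (∑ i ∈ s, p i) * coeff j (mixSeries (u • p) (s.erase i) ((∑ i ∈ s, p i) * (1 - u))) ≤
      min 1 (∑ i ∈ s, p i) * ((∑ i ∈ s, p i) ^ j / j.factorial) := by
  have hx : 0 ≤ ∑ i ∈ s, p i := Finset.sum_nonneg hp
  have hq : ∀ k ∈ s.erase i, 0 ≤ (u • p) k := fun k hk =>
    mul_nonneg hu.1 (hp k (Finset.mem_of_mem_erase hk))
  have hq' : ∀ k ∈ s.erase i, (u • p) k ≤ 1 := fun k hk =>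
    mul_le_one₀ hu.2 (hp k (Finset.mem_of_mem_erase hk)) (hp' k (Finset.mem_of_mem_erase hk))
  have hx' : 0 ≤ (∑ i ∈ s, p i) * (1 - u) := mul_nonneg hx (by linarith [hu.2])
  have hL : ∑ k ∈ s.erase i, (u • p) k + (∑ i ∈ s, p i) * (1 - u) = ∑ i ∈ s, p i - u * p i := by
    simp only [Pi.smul_apply, smul_eq_mul, ← Finset.mul_sum, ← Finset.add_sum_erase s p hi]
    ring
  have hL0 : 0 ≤ ∑ i ∈ s, p i - u * p i := by
    rw [← hL]; exact add_nonneg (Finset.sum_nonneg hq) hx'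
  have hup : 0 ≤ u * p i := mul_nonneg hu.1 (hp i hi)
  have hup' : u * p i ≤ 1 := mul_le_one₀ hu.2 (hp i hi) (hp' i hi)
  have hb := fun n k => coeff_mixSeries_mul_factorial_le hq hq' hx' n k
  have hb0 := coeff_zero_mixSeries_le (x := (∑ i ∈ s, p i) * (1 - u)) hq'
  rw [hL] at hb hb0
  generalize mixSeries (u • p) (s.erase i) ((∑ i ∈ s, p i) * (1 - u)) = G at *
  generalize ∑ i ∈ s, p i = x at *
  have hle : x - u * p i ≤ x := by linarith
  rw [min_mul_of_nonneg _ _ (by positivity), one_mul]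
  refine le_min ?_ ?_
  -- For `j = 0` the bound by `1` is `x e^{1-x} ≤ 1`. For positive `j` the recursion starts at `n =
  -- 1`, leaving one power of `x` to absorb the prefactor.
  · cases j with
    | zero =>
      simp only [pow_zero, Nat.factorial_zero, Nat.cast_one, div_one]
      calc x * coeff 0 G ≤ x * Real.exp (-(x - u * p i)) := by gcongr
        _ ≤ x * Real.exp (-(x - 1)) := by gcongr
        _ ≤ Real.exp (x - 1) * Real.exp (-(x - 1)) := by
          gcongr; linarith [Real.add_one_le_exp (x - 1)]
        _ = 1 := by rw [← Real.exp_add]; simp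
    | succ j =>
      have h1 := hb 1 j
      rw [add_comm 1 j, Nat.factorial_one, Nat.cast_one, mul_one] at h1
      rw [le_div_iff₀ (by positivity), mul_assoc, pow_succ']
      refine mul_le_mul_of_nonneg_left (h1.trans ?_) hx
      gcongr
  · have h1 := hb 0 j
    rw [zero_add, Nat.factorial_zero, Nat.cast_one, mul_one] at h1
    refine mul_le_mul_of_nonneg_left ?_ hx
    rw [le_div_iff₀ (by positivity)]
    refine h1.trans ?_
    gcongr

end Series

/-- Comparison of the stop-loss transforms of a sum of independent Bernoulli variables and of the
Poisson variable with the same mean. -/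
lemma stopLoss_pois_sub_stopLoss_bernPoly {ι : Type*} {p : ι → ℝ} {s : Finset ι} {r : ℝ}
    (hp : ∀ i ∈ s, 0 ≤ p i) (hp' : ∀ i ∈ s, p i ≤ 1) (hr : ∀ i ∈ s, p i ≤ r) (hr0 : 0 ≤ r)
    (j : ℕ) :
    |stopLoss (pois (∑ i ∈ s, p i)) (∑ i ∈ s, p i) j -
        stopLoss (fun k => (bernPoly p s).coeff k) (∑ i ∈ s, p i) j| ≤
      r / 2 * (min 1 (∑ i ∈ s, p i) * ((∑ i ∈ s, p i) ^ j / j.factorial)) := by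
  classical
  set x := ∑ i ∈ s, p i with hx
  have hx0 : 0 ≤ x := Finset.sum_nonneg hp
  set M := min 1 x * (x ^ j / j.factorial) with hM
  have hM0 : 0 ≤ M := by positivity
  set f : ℝ → ℝ := fun u => stopLoss (fun k => PowerSeries.coeff k
        (mixSeries (u • p) s (x * (1 - u)))) x j with hf
  have hf0 : f 0 = stopLoss (pois x) x j := by
    simp [hf, mixSeries, bernSeries, bernPoly, poisSeries]
  have hf1 : f 1 = stopLoss (fun k => (bernPoly p s).coeff k) x j := by
    have : poisSeries 0 = 1 := by
      ext k
      cases k with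
      | zero => simp [poisSeries, pois_zero_right]
      | succ k => simp [poisSeries, pois_zero_succ, PowerSeries.coeff_one]
    simp [hf, mixSeries, bernSeries, this]
  set D : ℝ → ℝ := fun u => ∑ i ∈ s, p i ^ 2 *
        PowerSeries.coeff j (mixSeries (u • p) (s.erase i) (x * (1 - u))) with hD
  have hd : ∀ u, HasDerivAt f (-(u * D u)) u := fun u => hasDerivAt_stopLoss_mixSeries p s j u
  have hD0 : ∀ u ∈ Set.Icc (0 : ℝ) 1, 0 ≤ D u := fun u hu =>
    Finset.sum_nonneg fun i hi => mul_nonneg (sq_nonneg _) <| coeff_mixSeries_nonneg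
      (fun k hk => mul_nonneg hu.1 (hp k (Finset.mem_of_mem_erase hk)))
      (fun k hk => mul_le_one₀ hu.2 (hp k (Finset.mem_of_mem_erase hk))
        (hp' k (Finset.mem_of_mem_erase hk)))
      (mul_nonneg hx0 (by linarith [hu.2])) _
  have hDM : ∀ u ∈ Set.Icc (0 : ℝ) 1, D u ≤ r * M := by
    intro u hu
    rcases hx0.eq_or_lt with h0 | hpos
    · have hz : ∀ i ∈ s, p i = 0 := (Finset.sum_eq_zero_iff_of_nonneg hp).1 h0.symm
      have hDu : D u = 0 := Finset.sum_eq_zero fun i hi => by rw [hz i hi]; simp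
      rw [hDu]
      positivity
    · refine le_of_mul_le_mul_left ?_ hpos
      calc x * D u = ∑ i ∈ s, p i * p i *
            (x * PowerSeries.coeff j (mixSeries (u • p) (s.erase i) (x * (1 - u)))) := by
            rw [hD, Finset.mul_sum]
            exact Finset.sum_congr rfl fun i _ => by ring
        _ ≤ ∑ i ∈ s, p i * r * M := by
            refine Finset.sum_le_sum fun i hi => ?_
            have h1 := hp i hi
            have h2 := hr i hi
            have h3 := mul_coeff_mixSeries_erase_le hp hp' hu hi j
            calc _ ≤ p i * p i * M := mul_le_mul_of_nonneg_left h3 (by positivity)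
              _ ≤ _ := by gcongr
        _ = x * (r * M) := by rw [← Finset.sum_mul, ← Finset.sum_mul]; ring
  rw [← hf0, ← hf1]
  have hanti : AntitoneOn f (Set.Icc 0 1) := by
    refine antitoneOn_of_deriv_nonpos (convex_Icc 0 1)
      (fun u _ => (hd u).continuousAt.continuousWithinAt)
      (fun u _ => (hd u).differentiableAt.differentiableWithinAt) fun u hu => ?_
    have hu' := interior_subset hu
    rw [(hd u).deriv, neg_nonpos]
    exact mul_nonneg hu'.1 (hD0 u hu')
  -- The derivative of `f` is at least `-r M u`; the compensator `r M u² / 2` produces the constant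
  -- `r / 2`.
  have hd2 : ∀ u, HasDerivAt (fun u => f u + r * M * (u ^ 2 / 2))
      (-(u * D u) + r * M * u) u := fun u => by
    have := (hd u).add (((hasDerivAt_pow 2 u).div_const 2).const_mul (r * M))
    convert! this using 1
    push_cast; ring
  have hmono : MonotoneOn (fun u => f u + r * M * (u ^ 2 / 2)) (Set.Icc 0 1) := by
    refine monotoneOn_of_deriv_nonneg (convex_Icc 0 1)
      (fun u _ => (hd2 u).continuousAt.continuousWithinAt)
      (fun u _ => (hd2 u).differentiableAt.differentiableWithinAt) fun u hu => ?_
    have hu' := interior_subset hu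
    rw [(hd2 u).deriv]
    nlinarith [hDM u hu', hu'.1]
  have h1 := hanti (Set.left_mem_Icc.2 zero_le_one) (Set.right_mem_Icc.2 zero_le_one) zero_le_one
  have h2 := hmono (Set.left_mem_Icc.2 zero_le_one) (Set.right_mem_Icc.2 zero_le_one) zero_le_one
  rw [abs_of_nonneg (by linarith)]
  simp only at h2
  linarith

/-! ### Poisson costs -/

section PoissonExpectation

variable {h : ℕ → ℝ} {α : ℝ}

lemma summable_secondDiff_mul_stopLoss_pois
    (hs : Summable fun j : ℕ => |secondDiff h j| * (α ^ j / j.factorial)) {x : ℝ} (hx : 0 ≤ x)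
    (hxα : x ≤ α) : Summable fun j => |secondDiff h j| * stopLoss (pois x) x j := by
  refine Summable.of_nonneg_of_le
    (fun j => mul_nonneg (abs_nonneg _) (stopLoss_nonneg (pois_nonneg hx) (hasSum_pois x)
      (hasSum_mul_pois x) j)) (fun j => ?_) (hs.mul_right ((1 - Real.exp (-α)) * x))
  have h1 := stopLoss_pois_sub_le le_rfl hx hxα j
  rw [stopLoss_pois_zero] at h1
  have h2 := mul_le_mul_of_nonneg_left h1 (abs_nonneg (secondDiff h j))
  calc _ ≤ _ := by simpa using h2
    _ = _ := by ring

lemma hasSum_pois_mul (hs : Summable fun j : ℕ => |secondDiff h j| * (α ^ j / j.factorial)) {x : ℝ}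
    (hx : 0 ≤ x) (hxα : x ≤ α) :
    HasSum (fun k => pois x k * h k)
      (h 0 + x * (h 1 - h 0) + ∑' j, secondDiff h j * stopLoss (pois x) x j) :=
  hasSum_mul_of_summable_stopLoss (pois_nonneg hx) (hasSum_pois x) (hasSum_mul_pois x) h
    (summable_secondDiff_mul_stopLoss_pois hs hx hxα)

lemma abs_tsum_secondDiff_mul_sub_le {a b : ℕ → ℝ} {c : ℝ}
    (hs : Summable fun j : ℕ => |secondDiff h j| * (α ^ j / j.factorial))
    (ha : Summable fun j => |secondDiff h j| * a j) (ha0 : ∀ j, 0 ≤ a j)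
    (hb : Summable fun j => |secondDiff h j| * b j) (hb0 : ∀ j, 0 ≤ b j)
    (hab : ∀ j : ℕ, |a j - b j| ≤ c * (α ^ j / j.factorial)) :
    |∑' j, secondDiff h j * a j - ∑' j, secondDiff h j * b j| ≤
      c * ∑' j : ℕ, |secondDiff h j| * (α ^ j / j.factorial) := by
  have ha' : Summable fun j => secondDiff h j * a j :=
    Summable.of_abs (ha.congr fun j => by rw [abs_mul, abs_of_nonneg (ha0 j)])
  have hb' : Summable fun j => secondDiff h j * b j :=
    Summable.of_abs (hb.congr fun j => by rw [abs_mul, abs_of_nonneg (hb0 j)])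
  have hle : ∀ j : ℕ, ‖secondDiff h j * a j - secondDiff h j * b j‖ ≤
      c * (|secondDiff h j| * (α ^ j / j.factorial)) := fun j => by
    rw [Real.norm_eq_abs, ← mul_sub, abs_mul]
    calc _ ≤ |secondDiff h j| * (c * (α ^ j / j.factorial)) :=
          mul_le_mul_of_nonneg_left (hab j) (abs_nonneg _)
      _ = _ := by ring
  rw [← ha'.tsum_sub hb', ← tsum_mul_left, ← Real.norm_eq_abs]
  exact tsum_of_norm_bounded (hs.mul_left c).hasSum hle

lemma tsum_pois_mul_sub_le {x y : ℝ}
    (hs : Summable fun j : ℕ => |secondDiff h j| * (α ^ j / j.factorial)) (hx : 0 ≤ x)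
    (hxy : x ≤ y) (hy : y ≤ α) :
    ∑' k, pois y k * h k - ∑' k, pois x k * h k ≤
      (y - x) * ((h 1 - h 0) + (1 - Real.exp (-α)) *
        ∑' j : ℕ, |secondDiff h j| * (α ^ j / j.factorial)) := by
  have hy0 := hx.trans hxy
  rw [(hasSum_pois_mul hs hx (hxy.trans hy)).tsum_eq, (hasSum_pois_mul hs hy0 hy).tsum_eq]
  have h1 := abs_tsum_secondDiff_mul_sub_le (c := (1 - Real.exp (-α)) * (y - x)) hs
    (summable_secondDiff_mul_stopLoss_pois hs hy0 hy)
    (stopLoss_nonneg (pois_nonneg hy0) (hasSum_pois y) (hasSum_mul_pois y))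
    (summable_secondDiff_mul_stopLoss_pois hs hx (hxy.trans hy))
    (stopLoss_nonneg (pois_nonneg hx) (hasSum_pois x) (hasSum_mul_pois x)) fun j => by
      rw [abs_of_nonneg (sub_nonneg.2 (stopLoss_pois_mono hx hxy j))]
      refine (stopLoss_pois_sub_le hx hxy hy j).trans_eq ?_
      ring
  have h2 := (abs_le.1 h1).2
  linarith

lemma abs_pairing_bernPoly_sub_tsum_pois_le {ι : Type*} {p : ι → ℝ} {s : Finset ι} {r : ℝ}
    (hs : Summable fun j : ℕ => |secondDiff h j| * (α ^ j / j.factorial))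
    (hp : ∀ i ∈ s, 0 ≤ p i) (hp' : ∀ i ∈ s, p i ≤ 1) (hr : ∀ i ∈ s, p i ≤ r) (hr0 : 0 ≤ r)
    (hα : ∑ i ∈ s, p i ≤ α) :
    |pairing h (bernPoly p s) - ∑' k, pois (∑ i ∈ s, p i) k * h k| ≤
      r / 2 * min 1 α * ∑' j : ℕ, |secondDiff h j| * (α ^ j / j.factorial) := by
  set x := ∑ i ∈ s, p i with hxdef
  have hx : 0 ≤ x := Finset.sum_nonneg hp
  have hc := coeff_bernPoly_nonneg hp hp'
  have hb0 := stopLoss_nonneg hc (hasSum_coeff_bernPoly p s) (hasSum_mul_coeff_bernPoly p s)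
  have hdiff : ∀ j : ℕ, |stopLoss (pois x) x j - stopLoss (fun k => (bernPoly p s).coeff k) x j| ≤
      r / 2 * min 1 α * (α ^ j / j.factorial) := fun j => by
    refine (stopLoss_pois_sub_stopLoss_bernPoly hp hp' hr hr0 j).trans ?_
    rw [← hxdef, mul_assoc]
    have : 0 ≤ min 1 x := le_min zero_le_one hx
    have : 0 ≤ min 1 α := le_min zero_le_one (hx.trans hα)
    gcongr
  have hsp := summable_secondDiff_mul_stopLoss_pois hs hx hα
  -- The Bernoulli stop-loss is at most the Poisson one plus the comparison error, and both of these
  -- are summable.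
  have hsb : Summable fun j => |secondDiff h j| *
      stopLoss (fun k => (bernPoly p s).coeff k) x j := by
    refine Summable.of_nonneg_of_le (fun j => mul_nonneg (abs_nonneg _) (hb0 j)) (fun j => ?_)
      (hsp.add (hs.mul_left (r / 2 * min 1 α)))
    have h1 := mul_le_mul_of_nonneg_left (abs_le.1 (hdiff j)).1 (abs_nonneg (secondDiff h j))
    linarith
  rw [(hasSum_pois_mul hs hx hα).tsum_eq, abs_sub_comm,
    (hasSum_pairing h (bernPoly p s)).unique (hasSum_mul_of_summable_stopLoss hc
      (hasSum_coeff_bernPoly p s) (hasSum_mul_coeff_bernPoly p s) h hsb)]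
  rw [add_sub_add_left_eq_sub]
  exact abs_tsum_secondDiff_mul_sub_le hs hsp
    (stopLoss_nonneg (pois_nonneg hx) (hasSum_pois x) (hasSum_mul_pois x)) hsb hb0 hdiff

end PoissonExpectation

/-! ### Regularity of the Poisson costs and the constants `ζ` and `Λ` -/

section Costs

variable {E T : Type*} {𝒢 : Structure E T} {α ν : ℝ}

lemma poissonCost_eq_tsum (e : E) {x : ℝ} (hx : 0 ≤ x) :
    poissonCost 𝒢 e x = ∑' k, pois x k * 𝒢.cost e (1 + k) :=
  integral_poisson hx _

lemma poissonCost_nonneg (e : E) (x : ℝ) : 0 ≤ poissonCost 𝒢 e x :=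
  integral_nonneg fun _ => 𝒢.cost_nonneg _ _

lemma exp_mul_pois (x : ℝ) (j : ℕ) : Real.exp x * pois x j = x ^ j / j.factorial := by
  rw [pois, ← mul_div_assoc, ← mul_assoc, ← Real.exp_add, add_neg_cancel, Real.exp_zero, one_mul]

lemma SecondDiffBound.summable (hν : SecondDiffBound 𝒢 α ν) (hα : 0 ≤ α) (e : E) :
    Summable fun j : ℕ =>
      |secondDiff (fun k => 𝒢.cost e (1 + k)) j| * (α ^ j / j.factorial) := by
  refine (((integrable_poisson_iff hα).1 (hν e).1).mul_left (Real.exp α)).congr fun j => ?_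
  rw [← mul_assoc, exp_mul_pois, mul_comm]
  rfl

lemma SecondDiffBound.tsum_le (hν : SecondDiffBound 𝒢 α ν) (hα : 0 ≤ α) (e : E) :
    ∑' j : ℕ, |secondDiff (fun k => 𝒢.cost e (1 + k)) j| * (α ^ j / j.factorial) ≤
      Real.exp α * ν := by
  have h := (hν e).2
  rw [integral_poisson hα] at h
  refine le_of_eq_of_le ?_ (mul_le_mul_of_nonneg_left h (Real.exp_nonneg α))
  rw [← tsum_mul_left]
  congr 1; ext j
  rw [← mul_assoc, exp_mul_pois, mul_comm]
  rfl

lemma SecondDiffBound.nonneg (hν : SecondDiffBound 𝒢 α ν) (e : E) : 0 ≤ ν :=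
  (integral_nonneg fun _ => abs_nonneg _).trans (hν e).2

lemma poissonCost_sub_le [Finite E] (hν : SecondDiffBound 𝒢 α ν) (e : E) {x y : ℝ}
    (hx : 0 ≤ x) (hxy : x ≤ y) (hy : y ≤ α) :
    poissonCost 𝒢 e y - poissonCost 𝒢 e x ≤ (y - x) * zeta 𝒢 α ν := by
  have hα : 0 ≤ α := (hx.trans hxy).trans hy
  rw [poissonCost_eq_tsum e hx, poissonCost_eq_tsum e (hx.trans hxy)]
  refine (tsum_pois_mul_sub_le (hν.summable hα e) hx hxy hy).trans ?_
  refine mul_le_mul_of_nonneg_left ?_ (sub_nonneg.2 hxy)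
  have h1 : 𝒢.cost e 2 - 𝒢.cost e 1 ≤ ⨆ e, (𝒢.cost e 2 - 𝒢.cost e 1) :=
    le_ciSup (f := fun e => 𝒢.cost e 2 - 𝒢.cost e 1) (Set.finite_range _).bddAbove e
  have h2 : 0 ≤ 1 - Real.exp (-α) := sub_nonneg.2 (Real.exp_le_one_iff.2 (by linarith))
  have h3 := mul_le_mul_of_nonneg_left (hν.tsum_le hα e) h2
  have h4 : (1 - Real.exp (-α)) * (Real.exp α * ν) = (Real.exp α - 1) * ν := by
    have : Real.exp (-α) * Real.exp α = 1 := by rw [← Real.exp_add]; simp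
    linear_combination (-ν) * this
  rw [h4] at h3
  rw [zeta, add_comm]
  exact add_le_add h3 h1

lemma le_zeta [Finite E] :
    (Real.exp α - 1) * ν ≤ zeta 𝒢 α ν := by
  rw [zeta]
  exact le_add_of_nonneg_right
    (Real.iSup_nonneg fun e => sub_nonneg.2 (𝒢.cost_mono e (by norm_num)))

lemma abs_pairing_cost_sub_poissonCost_le {ι : Type*} {p : ι → ℝ} {s : Finset ι} {r : ℝ}
    (hν : SecondDiffBound 𝒢 α ν) (e : E)
    (hp : ∀ i ∈ s, 0 ≤ p i) (hp' : ∀ i ∈ s, p i ≤ 1) (hr : ∀ i ∈ s, p i ≤ r) (hr0 : 0 ≤ r)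
    (hα : ∑ i ∈ s, p i ≤ α) :
    |pairing (fun k => 𝒢.cost e (1 + k)) (bernPoly p s) - poissonCost 𝒢 e (∑ i ∈ s, p i)| ≤
      r / 2 * min 1 α * (Real.exp α * ν) := by
  have hx : 0 ≤ ∑ i ∈ s, p i := Finset.sum_nonneg hp
  have hα0 := hx.trans hα
  rw [poissonCost_eq_tsum e hx]
  refine (abs_pairing_bernPoly_sub_tsum_pois_le (hν.summable hα0 e) hp hp' hr hr0 hα).trans ?_
  exact mul_le_mul_of_nonneg_left (hν.tsum_le hα0 e)
    (mul_nonneg (by linarith) (le_min zero_le_one hα0))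

/-- The two-sided approximation errors add up to at most `2 Λ(r)`. -/
lemma zeta_mul_add_le_two_mul_Lam [Finite E] [Nonempty E] (hν : SecondDiffBound 𝒢 α ν)
    (hα : 0 ≤ α) {r : ℝ} (hr0 : 0 ≤ r) (hr1 : r < 1) :
    r * zeta 𝒢 α ν + 2 * (r / 2 * min 1 α * (Real.exp α * ν)) ≤ 2 * Lam 𝒢 α ν r := by
  obtain ⟨e⟩ := ‹Nonempty E›
  have hν0 := hν.nonneg e
  have hz := mul_le_mul_of_nonneg_left (le_zeta (𝒢 := 𝒢) (α := α) (ν := ν)) hr0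
  have hK : 1 ≤ Real.exp r / (1 - r) ^ 2 := by
    rw [le_div_iff₀ (by nlinarith)]
    nlinarith [Real.add_one_le_exp r]
  -- For `α ≤ 1` this is `(1 - α)(e^α - 1) ≥ 0`. The term `(e^α - 1) ν` is absorbed by the second
  -- copy of `ζ` in `2 Λ`, the term `α ν` by the first summand of `Λ`.
  have h1 : min 1 α * Real.exp α ≤ α + (Real.exp α - 1) := by
    have he : 1 ≤ Real.exp α := Real.one_le_exp hα
    rcases le_total 1 α with h | h
    · rw [min_eq_left h]; linarith
    · rw [min_eq_right h]; nlinarith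
  have h2 := mul_le_mul_of_nonneg_left h1 (mul_nonneg hr0 hν0)
  have h3 : α * ν * r * 1 ≤ α * ν * r * (Real.exp r / (1 - r) ^ 2) :=
    mul_le_mul_of_nonneg_left hK (by positivity)
  have h4 : α * ν / 2 * (r * Real.exp r / (1 - r) ^ 2) =
      α * ν * r * (Real.exp r / (1 - r) ^ 2) / 2 := by ring
  rw [Lam, h4]
  nlinarith

lemma Lam_nonneg [Finite E] [Nonempty E] (hν : SecondDiffBound 𝒢 α ν) (hα : 0 ≤ α) {r : ℝ}
    (hr0 : 0 ≤ r) (hr1 : r < 1) : 0 ≤ Lam 𝒢 α ν r := by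
  have h := zeta_mul_add_le_two_mul_Lam hν hα hr0 hr1
  obtain ⟨e⟩ := ‹Nonempty E›
  have hν0 := hν.nonneg e
  have hz : 0 ≤ zeta 𝒢 α ν :=
    (mul_nonneg (sub_nonneg.2 (Real.one_le_exp hα)) hν0).trans le_zeta
  have h0 : 0 ≤ min 1 α := le_min zero_le_one hα
  have h1 : 0 ≤ r * zeta 𝒢 α ν + 2 * (r / 2 * min 1 α * (Real.exp α * ν)) := by positivity
  linarith

lemma tendsto_Lam : Tendsto (Lam 𝒢 α ν) (𝓝 0) (𝓝 0) := by
  have h : ContinuousAt (Lam 𝒢 α ν) 0 := by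
    unfold Lam
    refine ContinuousAt.add (ContinuousAt.mul continuousAt_const (ContinuousAt.div ?_ ?_ ?_)) ?_
    · fun_prop
    · fun_prop
    · norm_num
    · fun_prop
  simpa [ContinuousAt, Lam] using h

section Monotonicity

variable {β : ℝ} {e : E}

/-- `derivWithin` is `0` where the function is not differentiable, so a positive lower bound forces
differentiability. -/
lemma differentiableOn_poissonCost (hβ : 0 < β)
    (hd : ∀ x ∈ Set.Icc 0 α, β ≤ derivWithin (poissonCost 𝒢 e) (Set.Icc 0 α) x) :
    DifferentiableOn ℝ (poissonCost 𝒢 e) (Set.Icc 0 α) := fun x hx =>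
  differentiableWithinAt_of_derivWithin_ne_zero (hβ.trans_le (hd x hx)).ne'

lemma mul_sub_le_poissonCost_sub (hβ : 0 < β)
    (hd : ∀ x ∈ Set.Icc 0 α, β ≤ derivWithin (poissonCost 𝒢 e) (Set.Icc 0 α) x) {x y : ℝ}
    (hx : x ∈ Set.Icc 0 α) (hy : y ∈ Set.Icc 0 α) (hxy : x ≤ y) :
    β * (y - x) ≤ poissonCost 𝒢 e y - poissonCost 𝒢 e x := by
  have hdiff := differentiableOn_poissonCost hβ hd
  refine (convex_Icc 0 α).mul_sub_le_image_sub_of_le_deriv hdiff.continuousOn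
    (hdiff.mono interior_subset) (fun z hz => ?_) x hx y hy hxy
  rw [← derivWithin_of_mem_nhds (mem_interior_iff_mem_nhds.1 hz)]
  exact hd z (interior_subset hz)

lemma mul_sq_le_poissonCost_sub_mul (hβ : 0 < β)
    (hd : ∀ x ∈ Set.Icc 0 α, β ≤ derivWithin (poissonCost 𝒢 e) (Set.Icc 0 α) x) {x y : ℝ}
    (hx : x ∈ Set.Icc 0 α) (hy : y ∈ Set.Icc 0 α) :
    β * (x - y) ^ 2 ≤ (poissonCost 𝒢 e x - poissonCost 𝒢 e y) * (x - y) := by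
  rcases le_total x y with h | h
  · nlinarith [mul_sub_le_poissonCost_sub hβ hd hx hy h]
  · nlinarith [mul_sub_le_poissonCost_sub hβ hd hy hx h]

end Monotonicity

end Costs

/-! ### Random loads as Bernoulli sums -/

namespace Bernoulli

variable {E T N : Type*} {𝒢 : Structure E T} {Γ : Bernoulli T N}
  {σ : Profile 𝒢 Γ}

open scoped Classical in
/-- The probability that player `i` is active and uses the resource `e`. -/
def useProb (𝒢 : Structure E T) (Γ : Bernoulli T N) (σ : Profile 𝒢 Γ) (e : E) (i : N) : ℝ :=
  Γ.prob i * ∑ s : 𝒢.strategies (Γ.type i), σ i s * (if e ∈ s.1 then 1 else 0)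

lemma IsMixed.useProb_nonneg (hσ : IsMixed 𝒢 Γ σ) (e : E) (i : N) : 0 ≤ useProb 𝒢 Γ σ e i :=
  mul_nonneg (Γ.prob_pos i).le <| Finset.sum_nonneg fun s _ =>
    mul_nonneg ((hσ i).1 s) (by split_ifs <;> norm_num)

lemma IsMixed.useProb_le_prob (hσ : IsMixed 𝒢 Γ σ) (e : E) (i : N) :
    useProb 𝒢 Γ σ e i ≤ Γ.prob i := by
  refine mul_le_of_le_one_right (Γ.prob_pos i).le ?_
  refine (Finset.sum_le_sum fun s _ => mul_le_of_le_one_right ((hσ i).1 s) ?_).trans_eq (hσ i).2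
  split_ifs <;> norm_num

lemma maxProb_nonneg (Γ : Bernoulli T N) : 0 ≤ Γ.maxProb :=
  Real.iSup_nonneg fun i => (Γ.prob_pos i).le

variable [Fintype N]

lemma prob_le_maxProb (Γ : Bernoulli T N) (i : N) : Γ.prob i ≤ Γ.maxProb :=
  le_ciSup (Set.finite_range Γ.prob).bddAbove i

lemma maxProb_lt_one (Γ : Bernoulli T N) : Γ.maxProb < 1 := by
  rcases isEmpty_or_nonempty N with h | h
  · rw [maxProb, Real.iSup_of_isEmpty]; exact one_pos
  · obtain ⟨i, hi⟩ := exists_eq_ciSup_of_finite (f := Γ.prob)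
    rw [maxProb, ← hi]
    exact Γ.prob_lt_one i

open scoped Classical in
/-- The generating polynomial of the load that a set of players puts on a resource. -/
lemma IsMixed.sum_outcomeProb_monomial (hσ : IsMixed 𝒢 Γ σ) (e : E) (I : Finset N) :
    ∑ ω : Outcome 𝒢 Γ, Polynomial.monomial (∑ i ∈ I, uses 𝒢 Γ i e ω) (outcomeProb 𝒢 Γ σ ω) =
      bernPoly (useProb 𝒢 Γ σ e) I := by
  -- The contribution of one player. By independence the weighted monomial of an outcome is the
  -- product of these, so summing over outcomes gives a product of one-player sums.
  set F : (i : N) → Bool → 𝒢.strategies (Γ.type i) → Polynomial ℝ := fun i b s =>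
    Polynomial.C ((if b then Γ.prob i else 1 - Γ.prob i) * σ i s) *
      (if i ∈ I ∧ b = true ∧ e ∈ s.1 then Polynomial.X else 1) with hF
  have hω : ∀ ω : Outcome 𝒢 Γ,
      Polynomial.monomial (∑ i ∈ I, uses 𝒢 Γ i e ω) (outcomeProb 𝒢 Γ σ ω) =
        ∏ i, F i (ω.1 i) (ω.2 i) := by
    intro ω
    rw [hF, Finset.prod_mul_distrib, ← map_prod, ← Polynomial.C_mul_X_pow_eq_monomial, outcomeProb]
    congr 1
    rw [← Finset.prod_pow_eq_pow_sum, ← Finset.prod_subset (Finset.subset_univ I)]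
    · refine Finset.prod_congr rfl fun i hi => ?_
      by_cases h : ω.1 i = true ∧ e ∈ (ω.2 i).1 <;> simp [uses, h, hi]
    · intro i _ hi
      simp [hi]
  have hsum : ∀ i, ∑ b, ∑ s, F i b s =
      if i ∈ I then Polynomial.C (1 - useProb 𝒢 Γ σ e i) +
        Polynomial.C (useProb 𝒢 Γ σ e i) * Polynomial.X else 1 := by
    intro i
    have h1 : ∑ s, Polynomial.C (σ i s) = 1 := by rw [← map_sum, (hσ i).2, map_one]
    have hfalse : ∑ s, F i false s = Polynomial.C (1 - Γ.prob i) := by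
      simp only [hF, Bool.false_eq_true, false_and, and_false, if_false, mul_one, map_mul]
      rw [← Finset.mul_sum, h1, mul_one]
    have htrue : ∑ s, F i true s = if i ∈ I then Polynomial.C (Γ.prob i - useProb 𝒢 Γ σ e i) +
        Polynomial.C (useProb 𝒢 Γ σ e i) * Polynomial.X else Polynomial.C (Γ.prob i) := by
      split_ifs with hi
      · have : ∀ s, F i true s = Polynomial.C (Γ.prob i) * Polynomial.C (σ i s) +
            Polynomial.C (Γ.prob i * (σ i s * (if e ∈ s.1 then 1 else 0))) *
              (Polynomial.X - 1) := by
          intro s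
          by_cases hs : e ∈ s.1 <;> simp [hF, hi, hs]
          ring
        rw [Finset.sum_congr rfl fun s _ => this s, Finset.sum_add_distrib, ← Finset.mul_sum, h1,
          ← Finset.sum_mul, ← map_sum, ← Finset.mul_sum, ← useProb, map_sub]
        ring
      · simp only [hF, hi, false_and, if_false, if_true, mul_one, map_mul]
        rw [← Finset.mul_sum, h1, mul_one]
    rw [Fintype.sum_bool, hfalse, htrue]
    split_ifs with hi
    · simp only [map_sub, map_one]; ring
    · rw [← map_add]; simp
  calc _ = ∑ u : N → Bool, ∑ s : (i : N) → 𝒢.strategies (Γ.type i), ∏ i, F i (u i) (s i) := by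
        rw [Finset.sum_congr rfl fun ω _ => hω ω, Fintype.sum_prod_type]
    _ = ∑ u : N → Bool, ∏ i, ∑ s, F i (u i) s := by
        refine Finset.sum_congr rfl fun u _ => ?_
        rw [Finset.prod_univ_sum, Fintype.piFinset_univ]
    _ = ∏ i, ∑ b, ∑ s, F i b s := by
        rw [Finset.prod_univ_sum, Fintype.piFinset_univ]
    _ = bernPoly (useProb 𝒢 Γ σ e) I := by
        rw [Finset.prod_congr rfl fun i _ => hsum i, Finset.prod_ite_mem, Finset.univ_inter,
          bernPoly]

lemma IsMixed.expect_comp_sum_uses (hσ : IsMixed 𝒢 Γ σ) (e : E) (I : Finset N) (φ : ℕ → ℝ) :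
    expect 𝒢 Γ σ (fun ω => φ (∑ i ∈ I, uses 𝒢 Γ i e ω)) =
      pairing φ (bernPoly (useProb 𝒢 Γ σ e) I) := by
  classical
  rw [← hσ.sum_outcomeProb_monomial e I, map_sum, expect]
  simp only [pairing_monomial]
  exact Finset.sum_congr rfl fun ω _ => mul_comm _ _

lemma IsMixed.outcomeProb_nonneg (hσ : IsMixed 𝒢 Γ σ) (ω : Outcome 𝒢 Γ) :
    0 ≤ outcomeProb 𝒢 Γ σ ω := by
  refine Finset.prod_nonneg fun i _ => mul_nonneg ?_ ((hσ i).1 _)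
  have := Γ.prob_pos i
  have := Γ.prob_lt_one i
  split_ifs <;> linarith

lemma IsMixed.loadLaw_real_apply (hσ : IsMixed 𝒢 Γ σ) (e : E) (A : Set ℕ) :
    (loadLaw 𝒢 Γ σ e).real A =
      pairing (A.indicator fun _ => 1) (bernPoly (useProb 𝒢 Γ σ e) Finset.univ) := by
  classical
  rw [← hσ.expect_comp_sum_uses, expect, loadLaw, measureReal_def, Measure.finsetSum_apply,
    ENNReal.toReal_sum]
  · refine Finset.sum_congr rfl fun ω _ => ?_
    rw [Measure.smul_apply, smul_eq_mul, ENNReal.toReal_mul,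
      ENNReal.toReal_ofReal (hσ.outcomeProb_nonneg ω), Measure.dirac_apply, load]
    congr 1
    by_cases h : ∑ i, uses 𝒢 Γ i e ω ∈ A <;> simp [h]
  · intro ω _
    rw [Measure.smul_apply, smul_eq_mul]
    exact ENNReal.mul_ne_top ENNReal.ofReal_ne_top (measure_ne_top _ _)

/-- Poisson approximation of the law of the load of a resource. -/
lemma IsMixed.tvDist_loadLaw_le (hσ : IsMixed 𝒢 Γ σ) (e : E) {x : ℝ} (hx : 0 ≤ x) :
    tvDist (loadLaw 𝒢 Γ σ e) (poisson x) ≤ Γ.maxProb + |∑ i, useProb 𝒢 Γ σ e i - x| := by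
  have h0 : ∀ i ∈ Finset.univ, 0 ≤ useProb 𝒢 Γ σ e i := fun i _ => hσ.useProb_nonneg e i
  have h1 : ∀ i ∈ Finset.univ, useProb 𝒢 Γ σ e i ≤ 1 := fun i _ =>
    (hσ.useProb_le_prob e i).trans (Γ.prob_lt_one i).le
  have h2 : ∀ i ∈ Finset.univ, useProb 𝒢 Γ σ e i ≤ Γ.maxProb := fun i _ =>
    (hσ.useProb_le_prob e i).trans (Γ.prob_le_maxProb i)
  refine ciSup_le fun A => ?_
  rw [hσ.loadLaw_real_apply, poisson_real_apply hx]
  refine (abs_sub_le _ (∑' k, A.indicator (pois (∑ i, useProb 𝒢 Γ σ e i)) k) _).trans ?_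
  exact add_le_add (abs_pairing_indicator_bernPoly_sub_le h0 h1 h2 Γ.maxProb_nonneg A)
    (abs_tsum_indicator_pois_sub_le (Finset.sum_nonneg h0) hx A)

/-- The expected cost of a resource for player `i`, compared with its Poisson cost at the expected
load. -/
lemma IsMixed.poissonCost_sub_expect_mem [Finite E] {α ν β : ℝ} (hσ : IsMixed 𝒢 Γ σ)
    (hν : SecondDiffBound 𝒢 α ν) (hβ : 0 < β) {e : E}
    (hd : ∀ x ∈ Set.Icc 0 α, β ≤ derivWithin (poissonCost 𝒢 e) (Set.Icc 0 α) x)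
    (hx : ∑ i, useProb 𝒢 Γ σ e i ≤ α) (i : N) :
    poissonCost 𝒢 e (∑ i, useProb 𝒢 Γ σ e i) -
        expect 𝒢 Γ σ (fun ω => 𝒢.cost e (1 + othersLoad 𝒢 Γ i e ω)) ∈
      Set.Icc (-(Γ.maxProb / 2 * min 1 α * (Real.exp α * ν)))
        (Γ.maxProb * zeta 𝒢 α ν + Γ.maxProb / 2 * min 1 α * (Real.exp α * ν)) := by
  classical
  have hothers : ∀ ω, othersLoad 𝒢 Γ i e ω = ∑ j ∈ Finset.univ.erase i, uses 𝒢 Γ j e ω := by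
    intro ω
    rw [othersLoad]
    congr 1
    ext j
    simp
  simp only [hothers]
  rw [hσ.expect_comp_sum_uses e _ fun k => 𝒢.cost e (1 + k)]
  have h0 := hσ.useProb_nonneg e
  have hle := Finset.add_sum_erase Finset.univ (useProb 𝒢 Γ σ e) (Finset.mem_univ i)
  have hr : ∀ j, useProb 𝒢 Γ σ e j ≤ Γ.maxProb := fun j =>
    (hσ.useProb_le_prob e j).trans (Γ.prob_le_maxProb j)
  have hx0 : 0 ≤ ∑ j ∈ Finset.univ.erase i, useProb 𝒢 Γ σ e j :=
    Finset.sum_nonneg fun j _ => h0 j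
  have hxy : ∑ j ∈ Finset.univ.erase i, useProb 𝒢 Γ σ e j ≤ ∑ j, useProb 𝒢 Γ σ e j := by
    linarith [h0 i]
  have key := abs_pairing_cost_sub_poissonCost_le (s := Finset.univ.erase i) hν e
    (fun j _ => h0 j)
    (fun j _ => (hσ.useProb_le_prob e j).trans (Γ.prob_lt_one j).le) (fun j _ => hr j)
    Γ.maxProb_nonneg (hxy.trans hx)
  rw [abs_le] at key
  -- Putting player `i` back raises the Poisson cost by an amount between `0` (monotonicity) and `r
  -- ζ` (Lipschitz bound).
  have h1 := poissonCost_sub_le hν e hx0 hxy hx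
  have h2 := mul_sub_le_poissonCost_sub hβ hd ⟨hx0, hxy.trans hx⟩ ⟨hx0.trans hxy, hx⟩ hxy
  have h3 : 0 ≤ β * (∑ j, useProb 𝒢 Γ σ e j - ∑ j ∈ Finset.univ.erase i, useProb 𝒢 Γ σ e j) :=
    mul_nonneg hβ.le (sub_nonneg.2 hxy)
  have hz : 0 ≤ zeta 𝒢 α ν :=
    (mul_nonneg (sub_nonneg.2 (Real.one_le_exp (hx0.trans (hxy.trans hx)))) (hν.nonneg e)).trans
      le_zeta
  have h4 : (∑ j, useProb 𝒢 Γ σ e j - ∑ j ∈ Finset.univ.erase i, useProb 𝒢 Γ σ e j) *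
      zeta 𝒢 α ν ≤ Γ.maxProb * zeta 𝒢 α ν :=
    mul_le_mul_of_nonneg_right (by linarith [hr i]) hz
  constructor <;> linarith [key.1, key.2]

end Bernoulli

/-! ### Approximate Wardrop equilibria -/

section Nonatomic

variable {E T : Type*} [Fintype T] {S : T → Finset (Finset E)} {c : E → ℝ → ℝ} {d d' : T → ℝ}
  {y y' : (t : T) → S t → ℝ} {x x' : E → ℝ}

lemma IsFeasible.sum_mul_load [Fintype E] (h : IsFeasible S d y x) (w : E → ℝ) :
    ∑ e, w e * x e = ∑ t, ∑ s, y t s * ∑ e ∈ s.1, w e := by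
  classical
  calc ∑ e, w e * x e = ∑ e, ∑ t, ∑ s : S t, y t s * (if e ∈ s.1 then w e else 0) := by
        refine Finset.sum_congr rfl fun e _ => ?_
        rw [h.load e, Finset.mul_sum]
        refine Finset.sum_congr rfl fun t _ => ?_
        rw [Finset.mul_sum]
        refine Finset.sum_congr rfl fun s _ => ?_
        by_cases hs : e ∈ s.1 <;> simp [hs, mul_comm]
    _ = ∑ t, ∑ s : S t, ∑ e, y t s * (if e ∈ s.1 then w e else 0) := by
        rw [Finset.sum_comm]
        exact Finset.sum_congr rfl fun t _ => Finset.sum_comm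
    _ = _ := by
        refine Finset.sum_congr rfl fun t _ => Finset.sum_congr rfl fun s _ => ?_
        rw [← Finset.mul_sum, Finset.sum_ite_mem, Finset.univ_inter]

lemma IsFeasible.load_nonneg (h : IsFeasible S d y x) (e : E) : 0 ≤ x e := by
  rw [h.load e]
  refine Finset.sum_nonneg fun t _ => Finset.sum_nonneg fun s _ => mul_nonneg (h.nonneg t s) ?_
  split_ifs <;> norm_num

lemma IsFeasible.load_le (h : IsFeasible S d y x) (e : E) : x e ≤ ∑ t, d t := by
  rw [h.load e]
  refine Finset.sum_le_sum fun t _ => ?_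
  rw [h.demand t]
  refine Finset.sum_le_sum fun s _ => mul_le_of_le_one_right (h.nonneg t s) ?_
  split_ifs <;> norm_num

lemma IsFeasible.demand_nonneg (h : IsFeasible S d y x) (t : T) : 0 ≤ d t := by
  rw [h.demand t]
  exact Finset.sum_nonneg fun s _ => h.nonneg t s

/-- A Wardrop equilibrium up to an error `ε`. -/
structure IsApproxWardrop (S : T → Finset (Finset E)) (c : E → ℝ → ℝ) (d : T → ℝ)
    (y : (t : T) → S t → ℝ) (x : E → ℝ) (ε : ℝ) : Prop where
  feasible : IsFeasible S d y x
  optimal : ∀ t, ∀ s s' : S t, 0 < y t s → ∑ e ∈ s.1, c e (x e) ≤ ∑ e ∈ s'.1, c e (x e) + ε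

lemma IsWardrop.isApproxWardrop (h : IsWardrop S c d y x) : IsApproxWardrop S c d y x 0 :=
  ⟨h.feasible, fun t s s' hs => by simpa using h.optimal t s s' hs⟩

lemma IsApproxWardrop.exists_value {ε C : ℝ} (h : IsApproxWardrop S c d y x ε) (hC : 0 ≤ C)
    (hc : ∀ t, ∀ s : S t, ∑ e ∈ s.1, c e (x e) ∈ Set.Icc 0 C) (t : T) :
    ∃ v ∈ Set.Icc 0 C, (∀ s : S t, v ≤ ∑ e ∈ s.1, c e (x e)) ∧
      ∀ s : S t, 0 < y t s → ∑ e ∈ s.1, c e (x e) ≤ v + ε := by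
  -- A type without strategies has demand `0`, so any value in `[0, C]` serves.
  rcases isEmpty_or_nonempty (S t) with h0 | h0
  · exact ⟨0, ⟨le_rfl, hC⟩, fun s => h0.elim s, fun s => h0.elim s⟩
  · obtain ⟨s₀, hs₀⟩ := Finite.exists_min fun s : S t => ∑ e ∈ s.1, c e (x e)
    exact ⟨_, hc t s₀, hs₀, fun s hs => h.optimal t s s₀ hs⟩

/-- With `v t` and `v' t` the least strategy costs of type `t` at the two loads, each flow pays at
least the minimal value under either cost vector, and at most that value plus its error under its
own. Expanding the product leaves `∑ (d t - d' t)(v t - v' t)`, and both values lie in `[0, C]`. -/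
lemma IsApproxWardrop.sum_sub_mul_sub_le [Fintype E] {ε ε' C : ℝ}
    (h : IsApproxWardrop S c d y x ε) (h' : IsApproxWardrop S c d' y' x' ε') (hC : 0 ≤ C)
    (hc : ∀ t, ∀ s : S t, ∑ e ∈ s.1, c e (x e) ∈ Set.Icc 0 C)
    (hc' : ∀ t, ∀ s : S t, ∑ e ∈ s.1, c e (x' e) ∈ Set.Icc 0 C) :
    ∑ e, (c e (x e) - c e (x' e)) * (x e - x' e) ≤
      ε * ∑ t, d t + ε' * ∑ t, d' t + C * ∑ t, |d t - d' t| := by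
  choose v hv hvle hvε using h.exists_value hC hc
  choose v' hv' hvle' hvε' using h'.exists_value hC hc'
  have upper : ∀ {d : T → ℝ} {y : (t : T) → S t → ℝ} {x z : E → ℝ} {ε : ℝ} {v : T → ℝ},
      IsFeasible S d y x → (∀ t, ∀ s : S t, 0 < y t s → ∑ e ∈ s.1, c e (z e) ≤ v t + ε) →
      ∑ e, c e (z e) * x e ≤ ∑ t, d t * (v t + ε) := by
    intro d y x z ε v hf hv
    rw [hf.sum_mul_load fun e => c e (z e)]
    refine Finset.sum_le_sum fun t _ => ?_
    rw [hf.demand t, Finset.sum_mul]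
    refine Finset.sum_le_sum fun s _ => ?_
    rcases (hf.nonneg t s).eq_or_lt with h0 | h0
    · rw [← h0, zero_mul, zero_mul]
    · exact mul_le_mul_of_nonneg_left (hv t s h0) h0.le
  have lower : ∀ {d : T → ℝ} {y : (t : T) → S t → ℝ} {x z : E → ℝ} {v : T → ℝ},
      IsFeasible S d y x → (∀ t, ∀ s : S t, v t ≤ ∑ e ∈ s.1, c e (z e)) →
      ∑ t, d t * v t ≤ ∑ e, c e (z e) * x e := by
    intro d y x z v hf hv
    rw [hf.sum_mul_load fun e => c e (z e)]
    refine Finset.sum_le_sum fun t _ => ?_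
    rw [hf.demand t, Finset.sum_mul]
    exact Finset.sum_le_sum fun s _ => mul_le_mul_of_nonneg_left (hv t s) (hf.nonneg t s)
  have u1 := upper h.feasible hvε
  have u2 := upper h'.feasible hvε'
  have l1 := lower h'.feasible hvle
  have l2 := lower h.feasible hvle'
  have hsum : ∑ e, (c e (x e) - c e (x' e)) * (x e - x' e) =
      ∑ e, c e (x e) * x e - ∑ e, c e (x e) * x' e - ∑ e, c e (x' e) * x e +
        ∑ e, c e (x' e) * x' e := by
    rw [← Finset.sum_sub_distrib, ← Finset.sum_sub_distrib, ← Finset.sum_add_distrib]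
    exact Finset.sum_congr rfl fun e _ => by ring
  have habs : ∑ t, (d t - d' t) * (v t - v' t) ≤ C * ∑ t, |d t - d' t| := by
    rw [Finset.mul_sum]
    refine Finset.sum_le_sum fun t _ => (le_abs_self _).trans ?_
    rw [abs_mul, mul_comm]
    refine mul_le_mul_of_nonneg_right ?_ (abs_nonneg _)
    rw [abs_le]
    constructor <;> linarith [(hv t).1, (hv t).2, (hv' t).1, (hv' t).2]
  have hexp : ∑ t, d t * (v t + ε) + ∑ t, d' t * (v' t + ε') - ∑ t, d' t * v t - ∑ t, d t * v' t =
      ε * ∑ t, d t + ε' * ∑ t, d' t + ∑ t, (d t - d' t) * (v t - v' t) := by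
    simp only [Finset.mul_sum, ← Finset.sum_add_distrib, ← Finset.sum_sub_distrib]
    exact Finset.sum_congr rfl fun t _ => by ring
  linarith

end Nonatomic

/-! ### The flow of an equilibrium of a Bernoulli game -/

namespace Bernoulli

variable {E T N : Type*} [Fintype N] {𝒢 : Structure E T} {Γ : Bernoulli T N}
  {σ : Profile 𝒢 Γ}

open scoped Classical in
/-- The expected flow of type `t` on each of its strategies. -/
def flow (𝒢 : Structure E T) (Γ : Bernoulli T N) (σ : Profile 𝒢 Γ) (t : T)
    (s : 𝒢.strategies t) : ℝ :=
  ∑ i, if Γ.type i = t then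
    Γ.prob i * (if h : s.1 ∈ 𝒢.strategies (Γ.type i) then σ i ⟨s.1, h⟩ else 0) else 0

lemma IsMixed.isFeasible_flow [Fintype T] (hσ : IsMixed 𝒢 Γ σ) :
    IsFeasible 𝒢.strategies Γ.demand (flow 𝒢 Γ σ) (fun e => ∑ i, useProb 𝒢 Γ σ e i) where
  nonneg t s := by
    refine Finset.sum_nonneg fun i _ => ?_
    split_ifs
    · exact mul_nonneg (Γ.prob_pos i).le ((hσ i).1 _)
    · simp
    · exact le_rfl
  demand t := by
    classical
    simp only [flow, demand]
    rw [Finset.sum_comm, Finset.sum_filter]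
    refine Finset.sum_congr rfl fun i _ => ?_
    by_cases h : Γ.type i = t
    · subst h
      simp only [if_true, Finset.coe_mem, dite_true, Subtype.coe_eta]
      rw [← Finset.mul_sum, (hσ i).2, mul_one]
    · simp [h]
  load e := by
    classical
    simp only [flow, Finset.sum_mul]
    rw [Finset.sum_congr rfl fun t _ => Finset.sum_comm, Finset.sum_comm]
    refine Finset.sum_congr rfl fun i _ => ?_
    rw [Finset.sum_eq_single (Γ.type i)]
    · simp only [if_true, Finset.coe_mem, dite_true, Subtype.coe_eta, mul_assoc]
      rw [← Finset.mul_sum, useProb]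
    · intro t _ ht
      simp [ht.symm]
    · simp

/-- Passes from a strategy carrying aggregate flow to one player whose equilibrium condition can be
invoked. -/
lemma exists_pos_of_flow_pos {t : T} {s : 𝒢.strategies t}
    (hs : 0 < flow 𝒢 Γ σ t s) : ∃ i, ∃ h : Γ.type i = t, 0 < σ i (h ▸ s) := by
  obtain ⟨i, _, hi⟩ := Finset.exists_lt_of_sum_lt (s := Finset.univ) (f := fun _ : N => (0 : ℝ))
    (by simpa [flow] using hs)
  by_cases h : Γ.type i = t
  · refine ⟨i, h, ?_⟩
    subst h
    simp only [if_true, Finset.coe_mem, dite_true, Subtype.coe_eta] at hi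
    exact (mul_pos_iff_of_pos_left (Γ.prob_pos i)).1 hi
  · simp [h] at hi

lemma card_le_maxCard [Fintype T] {t : T} (s : 𝒢.strategies t) : s.1.card ≤ maxCard 𝒢 :=
  (Finset.le_sup (f := Finset.card) s.2).trans
    (Finset.le_sup (f := fun t => (𝒢.strategies t).sup Finset.card) (Finset.mem_univ t))

/-- The flow of a Bayes-Nash equilibrium is an approximate Wardrop equilibrium. -/
lemma IsBNE.isApproxWardrop [Fintype E] [Fintype T] {α ν β : ℝ} (hσ : IsBNE 𝒢 Γ σ)
    (hν : SecondDiffBound 𝒢 α ν) (hβ : 0 < β)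
    (hd : ∀ e, ∀ x ∈ Set.Icc 0 α, β ≤ derivWithin (poissonCost 𝒢 e) (Set.Icc 0 α) x)
    (hα : 0 ≤ α) (htot : ∑ t, Γ.demand t ≤ α) :
    IsApproxWardrop 𝒢.strategies (poissonCost 𝒢) Γ.demand (flow 𝒢 Γ σ)
      (fun e => ∑ i, useProb 𝒢 Γ σ e i) (2 * maxCard 𝒢 * |Lam 𝒢 α ν Γ.maxProb|) := by
  have hfeas := hσ.mixed.isFeasible_flow
  refine ⟨hfeas, fun t s s' hs => ?_⟩
  obtain ⟨i, h, hi⟩ := exists_pos_of_flow_pos hs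
  subst h
  have hopt := hσ.optimal i s s' hi
  -- Without resources `ν`, and hence `Λ`, may be negative; the absolute value in the error covers
  -- this case.
  rcases isEmpty_or_nonempty E with hE | hE
  · have h0 : ∀ s : 𝒢.strategies (Γ.type i), s.1 = ∅ := fun s => Finset.eq_empty_of_isEmpty _
    rw [h0 s, h0 s']
    simp only [Finset.sum_empty, zero_add]
    positivity
  have e₀ : E := hE.some
  have hr := Γ.maxProb_nonneg
  have hmem := fun e => hσ.mixed.poissonCost_sub_expect_mem hν hβ (hd e)
    ((hfeas.load_le e).trans htot) i
  have hLam := zeta_mul_add_le_two_mul_Lam hν hα hr Γ.maxProb_lt_one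
  have hz : 0 ≤ zeta 𝒢 α ν :=
    (mul_nonneg (sub_nonneg.2 (Real.one_le_exp hα)) (hν.nonneg e₀)).trans le_zeta
  have hB : 0 ≤ Γ.maxProb / 2 * min 1 α * (Real.exp α * ν) := by
    have := le_min zero_le_one hα
    have := hν.nonneg e₀
    positivity
  generalize Γ.maxProb / 2 * min 1 α * (Real.exp α * ν) = B at *
  -- Per-resource errors: `A` on the strategy in use, `B` on the alternative, with `A + B ≤ 2 Λ`.
  set A := Γ.maxProb * zeta 𝒢 α ν + B with hA
  have hA0 : 0 ≤ A := by positivity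
  have h1 : ∑ e ∈ s.1, poissonCost 𝒢 e (∑ i, useProb 𝒢 Γ σ e i) ≤
      ∑ e ∈ s.1, expect 𝒢 Γ σ (fun ω => 𝒢.cost e (1 + othersLoad 𝒢 Γ i e ω)) +
        s.1.card * A := by
    rw [← nsmul_eq_mul, ← Finset.sum_const, ← Finset.sum_add_distrib]
    exact Finset.sum_le_sum fun e _ => by linarith [(hmem e).2]
  have h2 : ∑ e ∈ s'.1, expect 𝒢 Γ σ (fun ω => 𝒢.cost e (1 + othersLoad 𝒢 Γ i e ω)) ≤
      ∑ e ∈ s'.1, poissonCost 𝒢 e (∑ i, useProb 𝒢 Γ σ e i) + s'.1.card * B := by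
    rw [← nsmul_eq_mul, ← Finset.sum_const, ← Finset.sum_add_distrib]
    exact Finset.sum_le_sum fun e _ => by linarith [(hmem e).1]
  have h3 : (s.1.card : ℝ) * A ≤ maxCard 𝒢 * A :=
    mul_le_mul_of_nonneg_right (by exact_mod_cast card_le_maxCard s) hA0
  have h4 : (s'.1.card : ℝ) * B ≤ maxCard 𝒢 * B :=
    mul_le_mul_of_nonneg_right (by exact_mod_cast card_le_maxCard s') hB
  have h5 : (maxCard 𝒢 : ℝ) * (A + B) ≤ maxCard 𝒢 * (2 * |Lam 𝒢 α ν Γ.maxProb|) :=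
    mul_le_mul_of_nonneg_left (by linarith [le_abs_self (Lam 𝒢 α ν Γ.maxProb)])
      (Nat.cast_nonneg _)
  linarith

end Bernoulli

/-! ### Uniform cost bounds and existence by compactness -/

lemma sum_poissonCost_mem {E T : Type*} [Finite T] {𝒢 : Structure E T} {α β : ℝ} (hβ : 0 < β)
    (hd : ∀ e, ∀ x ∈ Set.Icc 0 α, β ≤ derivWithin (poissonCost 𝒢 e) (Set.Icc 0 α) x)
    {x : E → ℝ} (hx : ∀ e, x e ∈ Set.Icc 0 α) (t : T) (s : 𝒢.strategies t) :
    ∑ e ∈ s.1, poissonCost 𝒢 e (x e) ∈ Set.Icc 0 (maxCost 𝒢 α) := by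
  refine ⟨Finset.sum_nonneg fun e _ => poissonCost_nonneg e _, ?_⟩
  refine le_trans (Finset.sum_le_sum fun e _ => ?_)
    (le_ciSup (f := fun p : (t : T) × 𝒢.strategies t => ∑ e ∈ p.2.1, poissonCost 𝒢 e α)
      (Set.finite_range _).bddAbove ⟨t, s⟩)
  have h1 := mul_sub_le_poissonCost_sub hβ (hd e) (hx e)
    ⟨(hx e).1.trans (hx e).2, le_rfl⟩ (hx e).2
  have h2 := mul_nonneg hβ.le (sub_nonneg.2 (hx e).2)
  linarith

lemma maxCost_nonneg {E T : Type*} (𝒢 : Structure E T) (α : ℝ) : 0 ≤ maxCost 𝒢 α :=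
  Real.iSup_nonneg fun _ => Finset.sum_nonneg fun e _ => poissonCost_nonneg e _

lemma sqrt_add_le_sqrt_add_sqrt {a b : ℝ} (ha : 0 ≤ a) (hb : 0 ≤ b) : √(a + b) ≤ √a + √b := by
  rw [Real.sqrt_le_left (by positivity), add_sq, Real.sq_sqrt ha, Real.sq_sqrt hb]
  have : 0 ≤ 2 * √a * √b := by positivity
  linarith

/-- A limit of approximate Wardrop equilibria with vanishing errors is a Wardrop equilibrium. -/
lemma exists_isWardrop_of_tendsto {E T : Type*} [Fintype T] {S : T → Finset (Finset E)}
    {c : E → ℝ → ℝ} {α : ℝ} (hc : ∀ e, ContinuousOn (c e) (Set.Icc 0 α)) {d : T → ℝ}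
    {D : ℕ → T → ℝ} (hD : ∀ t, Tendsto (fun n => D n t) atTop (𝓝 (d t)))
    (hDα : ∀ n, ∑ t, D n t ≤ α) {ε : ℕ → ℝ} (hε : Tendsto ε atTop (𝓝 0))
    {y : ℕ → (t : T) → S t → ℝ} {x : ℕ → E → ℝ}
    (h : ∀ n, IsApproxWardrop S c (D n) (y n) (x n) (ε n)) :
    ∃ z : E → ℝ, IsWardropLoad S c d z := by
  classical
  have hmem : ∀ n, y n ∈ Set.univ.pi fun t => Set.univ.pi fun _ : S t => Set.Icc 0 α := by
    intro n t _ s _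
    refine ⟨(h n).feasible.nonneg t s, ?_⟩
    calc y n t s ≤ ∑ s, y n t s := Finset.single_le_sum (f := fun s => y n t s)
          (fun s _ => (h n).feasible.nonneg t s) (Finset.mem_univ s)
      _ = D n t := ((h n).feasible.demand t).symm
      _ ≤ ∑ t, D n t := Finset.single_le_sum (f := fun t => D n t)
          (fun t _ => (h n).feasible.demand_nonneg t) (Finset.mem_univ t)
      _ ≤ α := hDα n
  obtain ⟨w, _, φ, hφ, hw⟩ := (isCompact_univ_pi fun t : T =>
    isCompact_univ_pi fun _ : S t => isCompact_Icc (a := (0 : ℝ)) (b := α)).tendsto_subseq hmem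
  have hwt : ∀ t s, Tendsto (fun n => y (φ n) t s) atTop (𝓝 (w t s)) := fun t s =>
    tendsto_pi_nhds.1 (tendsto_pi_nhds.1 hw t) s
  set z : E → ℝ := fun e => ∑ t, ∑ s : S t, w t s * (if e ∈ s.1 then 1 else 0) with hz
  have hxz : ∀ e, Tendsto (fun n => x (φ n) e) atTop (𝓝 (z e)) := by
    intro e
    have : (fun n => x (φ n) e) =
        fun n => ∑ t, ∑ s : S t, y (φ n) t s * (if e ∈ s.1 then 1 else 0) := by
      ext n; rw [(h (φ n)).feasible.load e]
    rw [this]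
    exact tendsto_finsetSum _ fun t _ => tendsto_finsetSum _ fun s _ => (hwt t s).mul_const _
  have hxα : ∀ n e, x n e ∈ Set.Icc 0 α := fun n e =>
    ⟨(h n).feasible.load_nonneg e, ((h n).feasible.load_le e).trans (hDα n)⟩
  have hzα : ∀ e, z e ∈ Set.Icc 0 α := fun e =>
    isClosed_Icc.mem_of_tendsto (hxz e) (Eventually.of_forall fun n => hxα _ e)
  have hcz : ∀ e, Tendsto (fun n => c e (x (φ n) e)) atTop (𝓝 (c e (z e))) := fun e =>
    (hc e (z e) (hzα e)).tendsto.comp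
      (tendsto_nhdsWithin_iff.2 ⟨hxz e, Eventually.of_forall fun n => hxα _ e⟩)
  refine ⟨z, w, ⟨fun t s => ge_of_tendsto' (hwt t s) fun n => (h (φ n)).feasible.nonneg t s,
    fun t => ?_, fun e => ?_⟩, fun t s s' hs => ?_⟩
  · refine tendsto_nhds_unique ((hD t).comp hφ.tendsto_atTop) ?_
    have : (fun n => D n t) ∘ φ = fun n => ∑ s, y (φ n) t s := by
      ext n; exact (h (φ n)).feasible.demand t
    rw [this]
    exact tendsto_finsetSum _ fun s _ => hwt t s
  · rw [hz]
  · have hlim : Tendsto (fun n => ∑ e ∈ s'.1, c e (x (φ n) e) + ε (φ n)) atTop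
        (𝓝 (∑ e ∈ s'.1, c e (z e) + 0)) :=
      (tendsto_finsetSum _ fun e _ => hcz e).add (hε.comp hφ.tendsto_atTop)
    rw [add_zero] at hlim
    refine le_of_tendsto_of_tendsto (tendsto_finsetSum _ fun e _ => hcz e) hlim ?_
    -- A strategy with positive limit flow eventually carries flow, so its approximate optimality
    -- passes to the limit.
    filter_upwards [(hwt t s).eventually_const_lt hs] with n hn
    exact (h (φ n)).optimal t s s' hn

end CongestionGame

end

theorem mainTheorem12 {E T : Type*} [Fintype E] [Fintype T]
    (𝒢 : CongestionGame.Structure E T)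
    -- the sequence of Bernoulli congestion games
    (N : ℕ → Type*) [∀ n, Fintype (N n)]
    (Γ : (n : ℕ) → CongestionGame.Bernoulli T (N n))
    -- limit demands, and the asymptotic regime
    (d : T → ℝ)
    (hcard : Tendsto (fun n => Fintype.card (N n)) atTop atTop)
    (hprob : Tendsto (fun n => (Γ n).maxProb) atTop (𝓝 0))
    (hdemand : ∀ t, Tendsto (fun n => (Γ n).demand t) atTop (𝓝 (d t)))
    -- bound on the second differences of the costs
    (α ν : ℝ) (hα : ∑ t, d t < α) (hν : CongestionGame.SecondDiffBound 𝒢 α ν)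
    (htot : ∀ n, ∑ t, (Γ n).demand t ≤ α)
    -- lower bound on the derivatives of the Poisson costs
    (β : ℝ) (hβ : 0 < β)
    (hderiv : ∀ e, ∀ x ∈ Set.Icc 0 α,
      β ≤ derivWithin (CongestionGame.poissonCost 𝒢 e) (Set.Icc 0 α) x)
    -- Bayes-Nash equilibria
    (σ : (n : ℕ) → CongestionGame.Bernoulli.Profile 𝒢 (Γ n))
    (hσ : ∀ n, CongestionGame.Bernoulli.IsBNE 𝒢 (Γ n) (σ n)) :
    ∃ x : E → ℝ,
      -- `x` is the unique vector of Wardrop equilibrium loads of the limit game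
      (∀ x' : E → ℝ, CongestionGame.IsWardropLoad 𝒢.strategies
          (CongestionGame.poissonCost 𝒢) d x' ↔ x' = x) ∧
      ∀ n e, CongestionGame.tvDist
          (CongestionGame.Bernoulli.loadLaw 𝒢 (Γ n) (σ n) e) (CongestionGame.poisson (x e)) ≤
        (Γ n).maxProb
          + √(2 * α * CongestionGame.maxCard 𝒢 / β) * √(CongestionGame.Lam 𝒢 α ν (Γ n).maxProb)
          + √(2 * CongestionGame.maxCost 𝒢 α / β) * √(∑ t, |(Γ n).demand t - d t|) := by

  have hd0 : ∀ n t, 0 ≤ (Γ n).demand t := fun n t =>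
    (hσ n).mixed.isFeasible_flow.demand_nonneg t
  have hα0 : 0 ≤ α := (Finset.sum_nonneg fun t _ => ge_of_tendsto' (hdemand t) (hd0 · t)).trans
    hα.le
  have happrox := fun n => (hσ n).isApproxWardrop hν hβ hderiv hα0 (htot n)
  have hε : Tendsto (fun n => 2 * (CongestionGame.maxCard 𝒢 : ℝ) *
      |CongestionGame.Lam 𝒢 α ν (Γ n).maxProb|) atTop (𝓝 0) := by
    simpa using ((CongestionGame.tendsto_Lam.comp hprob).abs).const_mul
      (2 * (CongestionGame.maxCard 𝒢 : ℝ))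
  obtain ⟨x, y, hxy⟩ := CongestionGame.exists_isWardrop_of_tendsto
    (fun e => (CongestionGame.differentiableOn_poissonCost hβ (hderiv e)).continuousOn)
    hdemand htot hε happrox
  have hC := CongestionGame.maxCost_nonneg 𝒢 α
  have hmem : ∀ {D : T → ℝ} {y x}, CongestionGame.IsFeasible 𝒢.strategies D y x →
      ∑ t, D t ≤ α → ∀ e, x e ∈ Set.Icc 0 α := fun hf hD e =>
    ⟨hf.load_nonneg e, (hf.load_le e).trans hD⟩
  -- Strong monotonicity makes every summand of the variational inequality nonnegative, so the total
  -- bounds each resource separately. With `D = d` and `ε = 0` this is uniqueness; with the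
  -- equilibrium flow it is the rate.
  have hcompare : ∀ {D : T → ℝ} {w z} {ε : ℝ},
      CongestionGame.IsApproxWardrop 𝒢.strategies (CongestionGame.poissonCost 𝒢) D w z ε →
      ∑ t, D t ≤ α → ∀ e, β * (z e - x e) ^ 2 ≤
        ε * ∑ t, D t + CongestionGame.maxCost 𝒢 α * ∑ t, |D t - d t| := by
    intro D w z ε h hD e
    have hz := hmem h.feasible hD
    have hx := hmem hxy.feasible hα.le
    have key := h.sum_sub_mul_sub_le hxy.isApproxWardrop hC
      (CongestionGame.sum_poissonCost_mem hβ hderiv hz)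
      (CongestionGame.sum_poissonCost_mem hβ hderiv hx)
    rw [zero_mul, add_zero] at key
    have hsq := fun e =>
      CongestionGame.mul_sq_le_poissonCost_sub_mul hβ (hderiv e) (hz e) (hx e)
    refine (hsq e).trans (le_trans ?_ key)
    exact Finset.single_le_sum (f := fun e => (CongestionGame.poissonCost 𝒢 e (z e) -
      CongestionGame.poissonCost 𝒢 e (x e)) * (z e - x e))
      (fun e _ => le_trans (by positivity) (hsq e)) (Finset.mem_univ e)
  refine ⟨x, fun x' => ⟨?_, ?_⟩, fun n e => ?_⟩
  · rintro ⟨y', h'⟩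
    ext e
    have := hcompare h'.isApproxWardrop hα.le e
    simp only [zero_mul, sub_self, abs_zero, Finset.sum_const_zero, mul_zero, add_zero] at this
    have h0 : (x' e - x e) ^ 2 ≤ 0 := nonpos_of_mul_nonpos_right this hβ
    exact sub_eq_zero.1 (pow_eq_zero_iff two_ne_zero |>.1 (le_antisymm h0 (sq_nonneg _)))
  · rintro rfl
    exact ⟨y, hxy⟩
  · refine ((hσ n).mixed.tvDist_loadLaw_le e (hmem hxy.feasible hα.le e).1).trans ?_
    rw [add_assoc]
    refine add_le_add_right ?_ _
    have : Nonempty E := ⟨e⟩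
    have hLam : 0 ≤ CongestionGame.Lam 𝒢 α ν (Γ n).maxProb :=
      CongestionGame.Lam_nonneg hν hα0 (Γ n).maxProb_nonneg (Γ n).maxProb_lt_one
    have h1 := hcompare (happrox n) (htot n) e
    rw [abs_of_nonneg hLam] at h1
    have h2 := mul_le_mul_of_nonneg_left (htot n)
      (mul_nonneg (mul_nonneg zero_le_two (Nat.cast_nonneg (CongestionGame.maxCard 𝒢))) hLam)
    have hD : 0 ≤ ∑ t, |(Γ n).demand t - d t| := Finset.sum_nonneg fun t _ => abs_nonneg _
    have h3 := mul_nonneg hC hD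
    rw [← Real.sqrt_mul (by positivity), ← Real.sqrt_mul (by positivity)]
    refine (Real.abs_le_sqrt ?_).trans (CongestionGame.sqrt_add_le_sqrt_add_sqrt (by positivity) (by positivity))
    -- The comparison gives the demand term with constant `C`; the factor `2` in `2 C` is slack,
    -- supplied by `h3`.
    rw [div_mul_eq_mul_div, div_mul_eq_mul_div, ← add_div, le_div_iff₀ hβ]
    linarith
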